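/- A weighted hooked metric probability space (a block) is a tuple $\mathbf{B}=(B,D,H,P,W)$ in which $(B,D)$ is a complete separable metric space, $H\in B$ is a point (the hook), $P$ is a Borel probability measure on $B$ and $W\in\mathbb{R}_{\ge 0}$ is a weight. The space of blocks is equipped with the product of the Borel $\sigma$-algebra of the hooked Gromov--Prohorov pseudodistance $$d\big((B_1,D_1,H_1,P_1),(B_2,D_2,H_2,P_2)\big)=\inf_{E,\phi_1,\phi_2}\max\big(d_{\mathrm{Prohorov}}(\phi_{1\#}P_1,\phi_{2\#}P_2),\,d_E(\phi_1(H_1),\phi_2(H_2))\big)$$ (the infimum being over isometric embeddings $\phi_i:B_i\to E$ into complete separable metric spaces $E$) and the Borel $\sigma$-algebra of the weights. Let $\mathbf{B}_0,\mathbf{B}_1,\mathbf{B}_2,\dots$ be independent random blocks, $\mathbf{B}_n=(B_n,D_n',H_n',P_n',W_n)$, such that $\mathbf{B}_1,\mathbf{B}_2,\dots$ are identically distributed with $\mathbb{E}[W_1]>0$, while $\mathbf{B}_0$ may have a different distribution and satisfies $W_0>0$ almost surely. Put $\mathbf{G}_0=(G_0,D_0,H,P_0,S_0)=\mathbf{B}_0$;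 the hook $H$ of $\mathbf{B}_0$ is the master hook. For $n\ge 0$, given all blocks and the previous latches $v_1,\dots,v_n$, choose a latch $v_{n+1}\in G_n$ according to $P_n$; let $(G_{n+1},D_{n+1})$ be the metric space obtained by gluing $G_n$ and $B_{n+1}$ together at $v_{n+1}=H_{n+1}'$ (so that $D_{n+1}(x,y)=D_n(x,v_{n+1})+D_{n+1}'(H_{n+1}',y)$ for $x\in G_n$, $y\in B_{n+1}$), and put $$S_{n+1}=S_n+W_{n+1},\qquad P_{n+1}=\frac{S_n}{S_{n+1}}P_n+\frac{W_{n+1}}{S_{n+1}}P_{n+1}',$$ where the measures on the right are extended to $G_{n+1}$. For $n\ge 1$ let $\Delta_n=D_n(H,v_n)$ be the distance from the master hook to the $n$-th latch. Let $(W,\Delta')$ be distributed as $(W_1,D_1'(H_1',U))$, where, given $\mathbf{B}_1$, the point $U\in B_1$ is chosen according to $P_1'$. Theorem. Suppose that $\mathbb{E}[W^2]$, $\mathbb{E}[(W\Delta')^2]$, $\mathbb{E}[W(\Delta')^2]$ and $\mathbb{E}[(\Delta')^2]$ are finite. Then, as $n\to\infty$, $$\frac{\Delta_n}{\ln n}\longrightarrow\frac{\mathbb{E}[W\Delta']}{\mathbb{E}[W]}\quad\text{in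 probability},$$ and $$\frac{\Delta_n-\mathbb{E}[W]^{-1}\,\mathbb{E}[W\Delta']\,\ln n}{\sqrt{\ln n}}\longrightarrow\mathcal{N}\big(0,\ \mathbb{E}[W]^{-1}\,\mathbb{E}[W(\Delta')^2]\big)\quad\text{in distribution}$$ (where $\mathcal{N}(0,0)$ is the point mass at $0$). -/

import Mathlib

open MeasureTheory ProbabilityTheory Filter Topology
open scoped ENNReal NNReal

/-- A hooked (complete separable) metric probability space `(B, D, H, P)`. Complete separable metric
spaces have at most the cardinality of the continuum, so carriers in `Type` are enough. -/
structure HookedSpace : Type 1 where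
  /-- the underlying set -/
  carrier : Type
  [metric : MetricSpace carrier]
  [complete : CompleteSpace carrier]
  [separable : TopologicalSpace.SeparableSpace carrier]
  /-- the hook -/
  hook : carrier
  /-- the Borel probability measure -/
  measure : @Measure carrier (borel carrier)
  [isProbabilityMeasure : @IsProbabilityMeasure carrier (borel carrier) measure]

namespace HookedSpace

instance : CoeSort HookedSpace Type := ⟨HookedSpace.carrier⟩

instance (X : HookedSpace) : MetricSpace X := X.metric
instance (X : HookedSpace) : CompleteSpace X := X.complete
instance (X : HookedSpace) : TopologicalSpace.SeparableSpace X := X.separable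
instance (X : HookedSpace) : MeasurableSpace X := borel X
instance (X : HookedSpace) : BorelSpace X := ⟨rfl⟩
instance (X : HookedSpace) : IsProbabilityMeasure X.measure := X.isProbabilityMeasure

/-- The hooked Gromov-Prohorov (pseudo)distance: the infimum, over all isometric embeddings of both
spaces into a common complete separable metric space `E`, of the maximum of the Prohorov distance of
the push-forward measures and the distance of the images of the hooks. -/
noncomputable def gpEDist (X Y : HookedSpace) : ℝ≥0∞ :=
  ⨅ (E : Type) (_ : MetricSpace E) (_ : CompleteSpace E) (_ : TopologicalSpace.SeparableSpace E)
    (_ : MeasurableSpace E) (_ : BorelSpace E)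
    (φ : X → E) (ψ : Y → E) (_ : Isometry φ) (_ : Isometry ψ),
    max (levyProkhorovEDist (X.measure.map φ) (Y.measure.map ψ)) (edist (φ X.hook) (ψ Y.hook))

/-- The topology of the hooked Gromov-Prohorov distance. Isomorphic spaces are at distance zero, so
its open sets, and its Borel sets, are unions of isomorphism classes: a random element of this space
is a random isomorphism class, together with a choice of representatives. -/
instance : TopologicalSpace HookedSpace where
  IsOpen U := ∀ X ∈ U, ∃ ε : ℝ≥0∞, 0 < ε ∧ ∀ Y, gpEDist X Y < ε → Y ∈ U
  isOpen_univ := fun _ _ => ⟨1, one_pos, fun _ _ => Set.mem_univ _⟩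
  isOpen_inter := by
    intro U V hU hV X hX
    obtain ⟨ε, hε, h⟩ := hU X hX.1
    obtain ⟨δ, hδ, h'⟩ := hV X hX.2
    exact ⟨min ε δ, lt_min hε hδ, fun Y hY =>
      ⟨h Y (hY.trans_le (min_le_left _ _)), h' Y (hY.trans_le (min_le_right _ _))⟩⟩
  isOpen_sUnion := by
    intro S hS X hX
    obtain ⟨U, hU, hXU⟩ := hX
    obtain ⟨ε, hε, h⟩ := hS U hU X hXU
    exact ⟨ε, hε, fun Y hY => ⟨U, hU, h Y hY⟩⟩

instance : MeasurableSpace HookedSpace := borel HookedSpace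
instance : BorelSpace HookedSpace := ⟨rfl⟩

end HookedSpace

/-- A weighted hooked metric probability space `(B, D, H, P, W)`, with weight `W ≥ 0`; the product
carries the product σ-algebra. Both the blocks and the growing spaces are of this kind. -/
abbrev Block : Type 1 := HookedSpace × ℝ≥0

section Gluing

variable (X Y : HookedSpace) (v : X)

/-- The space obtained from the disjoint union of `X` and `Y` by identifying the point `v` of `X`
with the hook of `Y`, with the concatenated metric:
`dist x y = dist x v + dist Y.hook y` for `x` in `X` and `y` in `Y`. -/
abbrev Wedge : Type :=
  Metric.GlueSpace (Z := Unit) (Φ := fun _ => v) (Ψ := fun _ => Y.hook)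
    isometry_subsingleton isometry_subsingleton

namespace Wedge

/-- The inclusion of `X`. -/
noncomputable abbrev inl : X → Wedge X Y v :=
  Metric.toGlueL (Z := Unit) isometry_subsingleton isometry_subsingleton

/-- The inclusion of `Y`. -/
noncomputable abbrev inr : Y → Wedge X Y v :=
  Metric.toGlueR (Z := Unit) isometry_subsingleton isometry_subsingleton

theorem isometry_inl : Isometry (inl X Y v) := Metric.toGlueL_isometry _ _

theorem isometry_inr : Isometry (inr X Y v) := Metric.toGlueR_isometry _ _

theorem range_union : Set.range (inl X Y v) ∪ Set.range (inr X Y v) = Set.univ := by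
  refine Set.eq_univ_of_forall fun z => ?_
  obtain ⟨z, rfl⟩ := Quot.exists_rep z
  rcases z with x | y
  · exact Or.inl ⟨x, rfl⟩
  · exact Or.inr ⟨y, rfl⟩

instance : CompleteSpace (Wedge X Y v) := by
  rw [completeSpace_iff_isComplete_univ, ← range_union]
  refine IsComplete.union ?_ ?_
  · exact (isometry_inl X Y v).isUniformInducing.isComplete_range
  · exact (isometry_inr X Y v).isUniformInducing.isComplete_range

instance : TopologicalSpace.SeparableSpace (Wedge X Y v) := by
  rw [← TopologicalSpace.isSeparable_univ_iff, ← range_union]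
  exact (TopologicalSpace.isSeparable_range (isometry_inl X Y v).continuous).union
    (TopologicalSpace.isSeparable_range (isometry_inr X Y v).continuous)

noncomputable instance : MeasurableSpace (Wedge X Y v) := borel _
instance : BorelSpace (Wedge X Y v) := ⟨rfl⟩

/-- The weighted sum `S / (S + W) • P + W / (S + W) • P'` of the two measures, extended to the glued
space. The two weights do not vanish together in the growth process, whose initial weight is
positive; in that void case the first measure is kept. -/
noncomputable def measure (S W : ℝ≥0) : Measure (Wedge X Y v) :=
  if S + W = 0 then X.measure.map (inl X Y v)
  else (S / (S + W)) • X.measure.map (inl X Y v) + (W / (S + W)) • Y.measure.map (inr X Y v)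

instance (S W : ℝ≥0) : IsProbabilityMeasure (measure X Y v S W) := by
  have h1 : IsProbabilityMeasure (X.measure.map (inl X Y v)) :=
    Measure.isProbabilityMeasure_map (isometry_inl X Y v).continuous.measurable.aemeasurable
  have h2 : IsProbabilityMeasure (Y.measure.map (inr X Y v)) :=
    Measure.isProbabilityMeasure_map (isometry_inr X Y v).continuous.measurable.aemeasurable
  unfold measure
  split_ifs with h
  · exact h1
  · constructor
    rw [Measure.add_apply, Measure.smul_apply, Measure.smul_apply, measure_univ, measure_univ,
      ← add_smul, ← add_div, div_self h, one_smul]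

end Wedge

end Gluing

/-- Attaching the block `B` to the space `G` at the latch `v`. -/
noncomputable def attach (G : Block) (v : G.1) (B : Block) : Block :=
  ({ carrier := Wedge G.1 B.1 v
     hook := Wedge.inl G.1 B.1 v G.1.hook
     measure := Wedge.measure G.1 B.1 v G.2 B.2 }, G.2 + B.2)

/-- For a given sequence of blocks: the type of the possible sequences of latches `v₁, …, vₙ`,
together with the space `Gₙ` grown with these latches. -/
noncomputable def growth (b : ℕ → Block) : ℕ → (T : Type) × (T → Block)
  | 0 => ⟨Unit, fun _ => b 0⟩
  | n + 1 => ⟨(h : (growth b n).1) × ((growth b n).2 h).1,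
      fun p => attach ((growth b n).2 p.1) p.2 (b (n + 1))⟩

/-- The possible sequences of latches `v₁, …, vₙ`; here `vₖ₊₁` is a point of `Gₖ`. -/
abbrev Latches (b : ℕ → Block) (n : ℕ) : Type := (growth b n).1

/-- The space `Gₙ` grown from the given blocks with the given latches. -/
noncomputable abbrev grownSpace (b : ℕ → Block) (n : ℕ) (h : Latches b n) : Block :=
  (growth b n).2 h

/-- The insertion depths `(Δ₀, …, Δₙ)`, where `Δ₀ = 0` and `Δₖ` is the distance from the master hook
to the `k`-th latch. -/
noncomputable def depths (b : ℕ → Block) : (n : ℕ) → Latches b n → Fin (n + 1) → ℝ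
  | 0, _ => fun _ => 0
  | n + 1, h => Fin.snoc (α := fun _ => ℝ) (depths b n h.1)
      (dist (grownSpace b n h.1).1.hook h.2)

/-- The expectation of a function of the latches `v₁, …, vₙ` for given blocks: given the previous
latches, `vₖ₊₁` is chosen according to the probability measure of `Gₖ`. -/
noncomputable def latchExp (b : ℕ → Block) : (n : ℕ) → (Latches b n → ℝ≥0∞) → ℝ≥0∞
  | 0, F => F ()
  | n + 1, F => latchExp b n fun h => ∫⁻ v, F ⟨h, v⟩ ∂(grownSpace b n h).1.measure

/-- `Δ` is the process of insertion depths of the random recursive metric spaces built from the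
random blocks `B`: given all blocks, `(Δ₀, …, Δₙ)` is distributed as the depths of successive random
latches. -/
structure IsInsertionDepth {Ω : Type*} [MeasurableSpace Ω] (μ : Measure Ω) (B : ℕ → Ω → Block)
    (Δ : ℕ → Ω → ℝ) : Prop where
  measurable (n : ℕ) : Measurable (Δ n)
  condLaw (n : ℕ) (A : Set (ℕ → Block)) (s : Set (Fin (n + 1) → ℝ)) :
    MeasurableSet A → MeasurableSet s →
    μ {ω | (fun k => B k ω) ∈ A ∧ (fun k : Fin (n + 1) => Δ k ω) ∈ s} =
      ∫⁻ ω in {ω | (fun k => B k ω) ∈ A},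
        latchExp (fun k => B k ω) n (fun h => s.indicator 1 (depths (fun k => B k ω) n h)) ∂μ

/-- The moment `𝔼[W ^ p * Δ' ^ q]` of a random block, where `W` is its weight and `Δ'` is the
distance from its hook to a point `u` chosen according to its probability measure. -/
noncomputable def blockMoment {Ω : Type*} [MeasurableSpace Ω] (μ : Measure Ω) (B : Ω → Block)
    (p q : ℕ) : ℝ≥0∞ :=
  ∫⁻ ω, ∫⁻ u, ((B ω).2 : ℝ≥0∞) ^ p * edist (B ω).1.hook u ^ q ∂(B ω).1.measure ∂μ

/-!
The proof computes the law of a single insertion depth for given blocks, exactly, and then proves a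
central limit theorem for almost every sequence of blocks.

*The law for given blocks.* Let `L_k` be the law of the distance from the hook of the `k`-th block to
a random point of it. The depth law of `G_{n+1}` is the mixture, with weights `S_n / S_{n+1}` and
`W_{n+1} / S_{n+1}`, of the depth law of `G_n` and of `L_{n+1}` shifted by the depth of the latch.
That latch is itself distributed according to `P_n`, so averaging over the latches turns the shift
into a convolution (`latchExp_depthLaw`). Hence `Δ_{n+1}` is distributed, for given blocks, as a sum
of independent contributions of the blocks, the `k`-th of which is present with probability
`p_k = W_k / S_k`, and its characteristic function is `φ₀ * ∏ (1 + p_k * (φ_k - 1))`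
(`charFun_meanDepthLaw`). No joint law of the depths is needed. That all this is measurable in the
blocks rests on the semicontinuity of distribution functions of depth laws with respect to the
Gromov-Prohorov distance (`HookedSpace.measurable_depthLaw`).

*The limit for given blocks.* At arguments of the order `1 / √(ln n)` the product is the exponential
of `∑ p_k * (φ_k - 1)`, up to an error `O(1 / ln n)`, and a second order expansion of the `φ_k`
reduces everything to the sums of `p_k` times the conditional moments of the depths
(`tendsto_prod_charFun`). Summation by parts (`sum_div_partial_sum`) turns laws of large numbers into
logarithmic asymptotics of such sums (`tendsto_weighted_sum_div_log`). For the first moment, whose sum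
must be known up to `o(√(ln n))`, even a bounded error is obtained (`exists_centered_sum_le`): the
sum is compared with a multiple of `∑ p_k`, which telescopes to `ln S_n`
(`exists_sum_div_sub_log_le`), and the centered remainder is controlled by the variances of partial
sums (`ae_summable_abs_partial_sum_mul`). This is where the finite second moments of `W` and `W * Δ'`
enter.

*Conclusion.* Averaging over the blocks by dominated convergence, and Lévy's continuity theorem, give
the convergence in distribution. The law of large numbers follows on dividing by `√(ln n)`.
-/

/-! ### Depth laws -/

namespace HookedSpace

/-- The depth law of a hooked space: the distribution on `ℝ` of the distance from the hook to a
point chosen according to the probability measure of the space. -/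
noncomputable def depthLaw (X : HookedSpace) : Measure ℝ :=
  X.measure.map fun u => dist X.hook u

lemma measurable_dist_hook (X : HookedSpace) : Measurable fun u : X => dist X.hook u :=
  (continuous_const.dist continuous_id).measurable

instance (X : HookedSpace) : IsProbabilityMeasure X.depthLaw :=
  Measure.isProbabilityMeasure_map X.measurable_dist_hook.aemeasurable

lemma lintegral_depthLaw (X : HookedSpace) {f : ℝ → ℝ≥0∞} (hf : Measurable f) :
    ∫⁻ x, f x ∂X.depthLaw = ∫⁻ u, f (dist X.hook u) ∂X.measure :=
  lintegral_map hf X.measurable_dist_hook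

lemma ae_depthLaw_nonneg (X : HookedSpace) : ∀ᵐ x ∂X.depthLaw, 0 ≤ x := by
  rw [depthLaw, ae_map_iff X.measurable_dist_hook.aemeasurable measurableSet_Ici]
  exact ae_of_all _ fun _ => dist_nonneg

/-- Distribution functions of depth laws are compared by the Gromov-Prohorov distance: in a common
ambient space, both the measures and the hooks are moved by less than `ε`. -/
lemma depthLaw_Iic_le {X Y : HookedSpace} {ε : ℝ} (h : gpEDist X Y < ENNReal.ofReal ε) (r : ℝ) :
    Y.depthLaw (Set.Iic r) ≤ X.depthLaw (Set.Iic (r + 2 * ε)) + ENNReal.ofReal ε := by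
  have hε : 0 < ε := by
    by_contra hε
    simp [ENNReal.ofReal_of_nonpos (not_lt.1 hε)] at h
  simp only [gpEDist, iInf_lt_iff] at h
  obtain ⟨E, _, _, _, _, _, φ, ψ, hφ, hψ, h⟩ := h
  obtain ⟨h1, h2⟩ := max_lt_iff.1 h
  have hm : MeasurableSet {z : E | dist (ψ Y.hook) z ≤ r} :=
    (isClosed_le (continuous_const.dist continuous_id) continuous_const).measurableSet
  have key := right_measure_le_of_levyProkhorovEDist_lt h1 hm
  have e1 : Y.depthLaw (Set.Iic r) = Y.measure.map ψ {z : E | dist (ψ Y.hook) z ≤ r} := by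
    rw [depthLaw, Measure.map_apply Y.measurable_dist_hook measurableSet_Iic,
      Measure.map_apply hψ.continuous.measurable hm]
    congr 1
    ext u
    simp [hψ.dist_eq]
  rw [e1]
  refine key.trans (add_le_add_left ?_ _)
  rw [depthLaw, Measure.map_apply X.measurable_dist_hook measurableSet_Iic,
    Measure.map_apply hφ.continuous.measurable Metric.isOpen_thickening.measurableSet]
  refine measure_mono fun u hu => ?_
  obtain ⟨z, hz, hz'⟩ := Metric.mem_thickening_iff.1 hu
  rw [ENNReal.toReal_ofReal hε.le] at hz'
  rw [edist_lt_ofReal] at h2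
  have a1 := dist_triangle (φ X.hook) (ψ Y.hook) (φ u)
  have a2 := dist_triangle (ψ Y.hook) z (φ u)
  have a3 : dist (ψ Y.hook) z ≤ r := hz
  rw [dist_comm z] at a2
  rw [hφ.dist_eq] at a1
  simp only [Set.mem_preimage, Set.mem_Iic]
  linarith

/-- Distribution functions of depth laws are upper semicontinuous, hence Borel. -/
lemma measurable_depthLaw : Measurable depthLaw := by
  refine Measurable.measure_of_isPiSystem_of_isProbabilityMeasure
    (BorelSpace.measurable_eq.trans (borel_eq_generateFrom_Iic ℝ)) isPiSystem_Iic ?_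
  rintro _ ⟨r, rfl⟩
  refine measurable_of_Iio fun c => IsOpen.measurableSet ?_
  intro X hX
  replace hX : X.depthLaw (Set.Iic r) < c := hX
  have t1 : Tendsto (fun n : ℕ => X.depthLaw (Set.Iic (r + 2 * (1 / ((n : ℝ) + 1)))) +
      ENNReal.ofReal (1 / ((n : ℝ) + 1))) atTop (𝓝 (X.depthLaw (Set.Iic r) + 0)) := by
    have t0 := tendsto_one_div_add_atTop_nhds_zero_nat (𝕜 := ℝ)
    refine Tendsto.add ?_ (by simpa using ENNReal.tendsto_ofReal t0)
    have hI : ⋂ n : ℕ, Set.Iic (r + 2 * (1 / ((n : ℝ) + 1))) = Set.Iic r := by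
      ext x
      simp only [Set.mem_iInter, Set.mem_Iic]
      refine ⟨fun h => ?_, fun h n => h.trans (by simp; positivity)⟩
      have := ge_of_tendsto' (t0.const_mul 2 |>.const_add r) h
      simpa using this
    rw [← hI]
    refine tendsto_measure_iInter_atTop (fun n => measurableSet_Iic.nullMeasurableSet) ?_
      ⟨0, measure_ne_top _ _⟩
    intro m n hmn
    refine Set.Iic_subset_Iic.2 ?_
    have := Nat.one_div_le_one_div (α := ℝ) hmn
    linarith
  rw [add_zero] at t1
  obtain ⟨n, hn⟩ := (t1.eventually_lt_const hX).exists
  exact ⟨ENNReal.ofReal (1 / ((n : ℝ) + 1)), ENNReal.ofReal_pos.2 (by positivity),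
    fun Y hY => (depthLaw_Iic_le hY r).trans_lt hn⟩

/-- The depth laws as a Markov kernel on the space of hooked spaces. -/
noncomputable def depthKernel : Kernel HookedSpace ℝ := ⟨depthLaw, measurable_depthLaw⟩

instance : IsMarkovKernel depthKernel := ⟨fun X => inferInstanceAs (IsProbabilityMeasure X.depthLaw)⟩

end HookedSpace

open HookedSpace

lemma Wedge.dist_inl_inr (X Y : HookedSpace) (v x : X) (y : Y) :
    dist (Wedge.inl X Y v x) (Wedge.inr X Y v y) = dist x v + dist Y.hook y := by
  change Metric.glueDist (fun _ : Unit => v) (fun _ => Y.hook) 0 (Sum.inl x) (Sum.inr y) = _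
  simp [Metric.glueDist, dist_comm]

/-- The depth law of a glued space is the mixture of the depth law of the old space and of the depth
law of the new block shifted by the depth of the latch. -/
lemma lintegral_depthLaw_attach (G : Block) (v : G.1) (b : Block) (h : G.2 + b.2 ≠ 0)
    {f : ℝ → ℝ≥0∞} (hf : Measurable f) :
    ∫⁻ x, f x ∂(attach G v b).1.depthLaw =
      (G.2 / (G.2 + b.2) : ℝ≥0) * ∫⁻ x, f x ∂G.1.depthLaw +
      (b.2 / (G.2 + b.2) : ℝ≥0) * ∫⁻ y, f (dist G.1.hook v + y) ∂b.1.depthLaw := by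
  rw [lintegral_depthLaw _ hf, lintegral_depthLaw _ hf, lintegral_depthLaw _ (by fun_prop)]
  have hg : Measurable fun u : Wedge G.1 b.1 v => f (dist (Wedge.inl G.1 b.1 v G.1.hook) u) :=
    hf.comp (continuous_const.dist continuous_id).measurable
  change ∫⁻ u : Wedge G.1 b.1 v, f (dist (Wedge.inl G.1 b.1 v G.1.hook) u)
    ∂(Wedge.measure G.1 b.1 v G.2 b.2) = _
  rw [Wedge.measure, if_neg h, lintegral_add_measure, lintegral_smul_measure,
    lintegral_smul_measure, lintegral_map hg (Wedge.isometry_inl _ _ _).continuous.measurable,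
    lintegral_map hg (Wedge.isometry_inr _ _ _).continuous.measurable]
  simp only [(Wedge.isometry_inl _ _ _).dist_eq, Wedge.dist_inl_inr]
  rfl

/-! ### The law of an insertion depth for given blocks -/

/-- The total weight of the blocks `0, …, n`. -/
noncomputable def totalWeight (b : ℕ → Block) (n : ℕ) : ℝ≥0 := ∑ k ∈ Finset.range (n + 1), (b k).2

lemma totalWeight_succ (b : ℕ → Block) (n : ℕ) :
    totalWeight b (n + 1) = totalWeight b n + (b (n + 1)).2 := Finset.sum_range_succ _ _

lemma totalWeight_pos {b : ℕ → Block} (h : 0 < (b 0).2) (n : ℕ) : 0 < totalWeight b n :=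
  h.trans_le (Finset.single_le_sum (f := fun k => (b k).2) (fun _ _ => zero_le)
    (Finset.mem_range.2 n.succ_pos))

lemma grownSpace_snd (b : ℕ → Block) : ∀ (n : ℕ) (h : Latches b n),
    (grownSpace b n h).2 = totalWeight b n
  | 0, _ => by simp [grownSpace, growth, totalWeight]
  | n + 1, h => by
    rw [totalWeight_succ, ← grownSpace_snd b n h.1]
    rfl

/-- The law, for given blocks, of the depth of the latch chosen in the `n`-th grown space, averaged
over all previous latches. Averaging the depth law of a glued space over the latch turns the shift
by the depth of the latch into a convolution, whence the recursion. -/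
noncomputable def meanDepthLaw (b : ℕ → Block) : ℕ → Measure ℝ
  | 0 => (b 0).1.depthLaw
  | n + 1 => (totalWeight b n / totalWeight b (n + 1)) • meanDepthLaw b n +
      ((b (n + 1)).2 / totalWeight b (n + 1)) • (meanDepthLaw b n ∗ (b (n + 1)).1.depthLaw)

instance (b : ℕ → Block) (n : ℕ) : IsFiniteMeasure (meanDepthLaw b n) := by
  induction n with
  | zero => rw [meanDepthLaw]; infer_instance
  | succ n ih => rw [meanDepthLaw]; infer_instance

lemma latchExp_depthLaw {b : ℕ → Block} (h : 0 < (b 0).2) (n : ℕ) {f : ℝ → ℝ≥0∞}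
    (hf : Measurable f) :
    latchExp b n (fun l => ∫⁻ x, f x ∂(grownSpace b n l).1.depthLaw) =
      ∫⁻ x, f x ∂meanDepthLaw b n := by
  induction n generalizing f with
  | zero => rfl
  | succ n ih =>
    have hf' : Measurable fun x => ∫⁻ y, f (x + y) ∂(b (n + 1)).1.depthLaw :=
      (hf.comp measurable_add).lintegral_prod_right'
    set p : ℝ≥0 := totalWeight b n / totalWeight b (n + 1) with hp
    set q : ℝ≥0 := (b (n + 1)).2 / totalWeight b (n + 1) with hq
    have hpos := totalWeight_pos h (n + 1)
    have step : ∀ l : Latches b n, ∫⁻ v, (∫⁻ x, f x ∂(grownSpace b (n + 1) ⟨l, v⟩).1.depthLaw)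
        ∂(grownSpace b n l).1.measure =
        ∫⁻ x, (p * f x + q * ∫⁻ y, f (x + y) ∂(b (n + 1)).1.depthLaw)
          ∂(grownSpace b n l).1.depthLaw := by
      intro l
      have hw : (grownSpace b n l).2 = totalWeight b n := grownSpace_snd b n l
      have e : ∀ v, ∫⁻ x, f x ∂(grownSpace b (n + 1) ⟨l, v⟩).1.depthLaw =
          p * ∫⁻ x, f x ∂(grownSpace b n l).1.depthLaw +
          q * ∫⁻ y, f (dist (grownSpace b n l).1.hook v + y) ∂(b (n + 1)).1.depthLaw := by
        intro v
        have := lintegral_depthLaw_attach (grownSpace b n l) v (b (n + 1))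
          (by rw [hw, ← totalWeight_succ]; exact hpos.ne') hf
        rw [hw, ← totalWeight_succ] at this
        exact this
      simp only [e]
      have hm : Measurable fun v : (grownSpace b n l).1 =>
          ∫⁻ y, f (dist (grownSpace b n l).1.hook v + y) ∂(b (n + 1)).1.depthLaw :=
        hf'.comp (measurable_dist_hook _)
      rw [lintegral_add_left measurable_const, lintegral_const, measure_univ, mul_one,
        lintegral_const_mul _ hm, lintegral_add_left (hf.const_mul _), lintegral_const_mul _ hf,
        lintegral_const_mul _ hf', lintegral_depthLaw _ hf']
    change latchExp b n (fun l => ∫⁻ v, (∫⁻ x, f x ∂(grownSpace b (n + 1) ⟨l, v⟩).1.depthLaw)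
        ∂(grownSpace b n l).1.measure) = _
    simp only [step]
    rw [ih (f := fun x => p * f x + q * ∫⁻ y, f (x + y) ∂(b (n + 1)).1.depthLaw)
      ((hf.const_mul _).add (hf'.const_mul _)), lintegral_add_left (hf.const_mul _),
      lintegral_const_mul _ hf, lintegral_const_mul _ hf', meanDepthLaw, lintegral_add_measure,
      lintegral_smul_measure, lintegral_smul_measure, Measure.lintegral_conv hf]
    rfl

lemma latchExp_depths_last {b : ℕ → Block} (h : 0 < (b 0).2) (n : ℕ) {s : Set ℝ}
    (hs : MeasurableSet s) :
    latchExp b (n + 1) (fun l => ((fun x : Fin (n + 2) → ℝ => x (Fin.last _)) ⁻¹' s).indicator 1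
      (depths b (n + 1) l)) = meanDepthLaw b n s := by
  rw [← lintegral_indicator_one hs, ← latchExp_depthLaw h n (measurable_one.indicator hs)]
  change latchExp b n (fun l => ∫⁻ v, ((fun x : Fin (n + 2) → ℝ => x (Fin.last _)) ⁻¹' s).indicator
    1 (depths b (n + 1) ⟨l, v⟩) ∂(grownSpace b n l).1.measure) = _
  congr 1
  ext l
  rw [lintegral_depthLaw _ (measurable_one.indicator hs)]
  refine lintegral_congr fun v => ?_
  have e : depths b (n + 1) ⟨l, v⟩ (Fin.last _) = dist (grownSpace b n l).1.hook v := by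
    simp only [depths, Fin.snoc_last]
  rw [← e]
  rfl

/-- For given blocks, the depth of a latch is distributed as a sum of independent contributions of
the blocks, the `k`-th of which is present with probability `Wₖ / Sₖ`. -/
lemma charFun_meanDepthLaw (b : ℕ → Block) (h : 0 < (b 0).2) (n : ℕ) (t : ℝ) :
    charFun (meanDepthLaw b n) t = charFun (b 0).1.depthLaw t *
      ∏ k ∈ Finset.range n, (1 + (((b (k + 1)).2 / totalWeight b (k + 1) : ℝ≥0) : ℂ) *
        (charFun (b (k + 1)).1.depthLaw t - 1)) := by
  induction n with
  | zero => simp [meanDepthLaw]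
  | succ n ih =>
    have hi : ∀ (ν : Measure ℝ) [IsFiniteMeasure ν],
        Integrable (fun x : ℝ => Complex.exp (t * x * Complex.I)) ν := by
      intro ν _
      refine Integrable.of_bound (by fun_prop) 1 (ae_of_all _ fun x => ?_)
      rw [← Complex.ofReal_mul, Complex.norm_exp_ofReal_mul_I]
    have hp : ((totalWeight b n / totalWeight b (n + 1) : ℝ≥0) : ℂ) =
        1 - (((b (n + 1)).2 / totalWeight b (n + 1) : ℝ≥0) : ℂ) := by
      have h0 : ((totalWeight b (n + 1) : ℝ≥0) : ℂ) ≠ 0 := by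
        exact_mod_cast (totalWeight_pos h (n + 1)).ne'
      have h1 : ((totalWeight b (n + 1) : ℝ≥0) : ℂ) = totalWeight b n + (b (n + 1)).2 := by
        rw [totalWeight_succ]; push_cast; rfl
      push_cast
      field_simp
      rw [h1]; ring
    have e : charFun (meanDepthLaw b (n + 1)) t =
        ((totalWeight b n / totalWeight b (n + 1) : ℝ≥0) : ℂ) * charFun (meanDepthLaw b n) t +
        (((b (n + 1)).2 / totalWeight b (n + 1) : ℝ≥0) : ℂ) *
          (charFun (meanDepthLaw b n) t * charFun (b (n + 1)).1.depthLaw t) := by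
      rw [← charFun_conv]
      simp only [charFun_apply_real, meanDepthLaw]
      rw [integral_add_measure (hi _) (hi _), integral_smul_nnreal_measure,
        integral_smul_nnreal_measure]
      rfl
    rw [e, Finset.prod_range_succ, ← mul_assoc (charFun (b 0).1.depthLaw t), ← ih, hp]
    ring

lemma meanDepthLaw_univ_le (b : ℕ → Block) (n : ℕ) : meanDepthLaw b n Set.univ ≤ 1 := by
  induction n with
  | zero => rw [meanDepthLaw]; exact prob_le_one
  | succ n ih =>
    have hc : (meanDepthLaw b n ∗ (b (n + 1)).1.depthLaw) Set.univ = meanDepthLaw b n Set.univ := by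
      rw [Measure.conv, Measure.map_apply measurable_add MeasurableSet.univ, Set.preimage_univ,
        ← Set.univ_prod_univ, Measure.prod_prod,
        measure_univ (μ := (b (n + 1)).1.depthLaw), mul_one]
    rw [meanDepthLaw, Measure.add_apply, Measure.smul_apply, Measure.smul_apply, hc, ← add_smul,
      ← add_div, ← totalWeight_succ]
    calc _ ≤ (1 : ℝ≥0) • meanDepthLaw b n Set.univ := by
          gcongr
          exact div_self_le_one _
      _ ≤ 1 := by rwa [one_smul]

lemma measurable_totalWeight (n : ℕ) : Measurable fun b : ℕ → Block => totalWeight b n := by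
  unfold totalWeight
  fun_prop

lemma measurable_meanDepthLaw (n : ℕ) : Measurable fun b : ℕ → Block => meanDepthLaw b n := by
  induction n with
  | zero =>
    simp only [meanDepthLaw]
    exact measurable_depthLaw.comp (by fun_prop)
  | succ n ih =>
    let κ : Kernel (ℕ → Block) ℝ := ⟨fun b => meanDepthLaw b n, ih⟩
    let η : Kernel (ℕ → Block) ℝ :=
      ⟨fun b => (b (n + 1)).1.depthLaw, measurable_depthLaw.comp (by fun_prop)⟩
    have : IsFiniteKernel κ := ⟨1, ENNReal.one_lt_top, fun b => meanDepthLaw_univ_le b n⟩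
    have : IsMarkovKernel η := ⟨fun b => inferInstanceAs (IsProbabilityMeasure (b _).1.depthLaw)⟩
    refine Measure.measurable_of_measurable_coe _ fun s hs => ?_
    have e : ∀ b : ℕ → Block, meanDepthLaw b (n + 1) s =
        (totalWeight b n / totalWeight b (n + 1) : ℝ≥0) * κ b s +
          ((b (n + 1)).2 / totalWeight b (n + 1) : ℝ≥0) *
            (κ ×ₖ η).map (fun x : ℝ × ℝ => x.1 + x.2) b s := by
      intro b
      rw [meanDepthLaw, Measure.add_apply, Measure.smul_apply, Measure.smul_apply,
        Kernel.map_apply _ measurable_add, Kernel.prod_apply]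
      rfl
    simp only [e]
    have m1 := measurable_totalWeight n
    have m2 := measurable_totalWeight (n + 1)
    have m3 := κ.measurable_coe hs
    have m4 := ((κ ×ₖ η).map (fun x : ℝ × ℝ => x.1 + x.2)).measurable_coe hs
    fun_prop

lemma stronglyMeasurable_charFun_meanDepthLaw (n : ℕ) (t : ℝ) :
    StronglyMeasurable fun b : ℕ → Block => charFun (meanDepthLaw b n) t := by
  let κ : Kernel (ℕ → Block) ℝ := ⟨fun b => meanDepthLaw b n, measurable_meanDepthLaw n⟩
  have h : Measurable fun x : ℝ => Complex.exp (t * x * Complex.I) := by fun_prop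
  have := h.stronglyMeasurable.integral_kernel (κ := κ)
  simp only [charFun_apply_real]
  exact this

lemma norm_charFun_meanDepthLaw_le (b : ℕ → Block) (n : ℕ) (t : ℝ) :
    ‖charFun (meanDepthLaw b n) t‖ ≤ 1 :=
  (norm_charFun_le t).trans (ENNReal.toReal_le_of_le_ofReal zero_le_one
    (by simpa using meanDepthLaw_univ_le b n))

/-- The law of an insertion depth is the mixture of the laws for given blocks, so the
characteristic functions are averaged over the blocks. -/
lemma IsInsertionDepth.charFun_map {Ω : Type*} [MeasurableSpace Ω] {μ : Measure Ω}
    [IsProbabilityMeasure μ] {B : ℕ → Ω → Block} {Δ : ℕ → Ω → ℝ} (hΔ : IsInsertionDepth μ B Δ)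
    (hB : ∀ n, Measurable (B n)) (hW₀ : ∀ᵐ ω ∂μ, 0 < (B 0 ω).2) (n : ℕ) (t : ℝ) :
    charFun (μ.map (Δ (n + 1))) t = ∫ ω, charFun (meanDepthLaw (fun j => B j ω) n) t ∂μ := by
  let κ : Kernel Ω ℝ :=
    ⟨fun ω => meanDepthLaw (fun j => B j ω) n, (measurable_meanDepthLaw n).comp (by fun_prop)⟩
  have e : μ.map (Δ (n + 1)) = κ ∘ₘ μ := by
    ext s hs
    rw [Measure.map_apply (hΔ.measurable _) hs, Measure.bind_apply hs κ.aemeasurable]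
    have := hΔ.condLaw (n + 1) Set.univ ((fun x : Fin (n + 2) → ℝ => x (Fin.last _)) ⁻¹' s)
      MeasurableSet.univ (by measurability)
    simp only [Set.mem_univ, true_and, Set.ofPred_true, Measure.restrict_univ] at this
    refine Eq.trans (by rfl) (this.trans (lintegral_congr_ae ?_))
    filter_upwards [hW₀] with ω hω
    exact latchExp_depths_last hω n hs
  have hi : Integrable (fun x : ℝ => Complex.exp (t * x * Complex.I)) (κ ∘ₘ μ) := by
    have : IsFiniteKernel κ := ⟨1, ENNReal.one_lt_top, fun b => meanDepthLaw_univ_le _ n⟩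
    refine Integrable.of_bound (by fun_prop) 1 (ae_of_all _ fun x => ?_)
    rw [← Complex.ofReal_mul, Complex.norm_exp_ofReal_mul_I]
  rw [e, charFun_apply_real]
  have hc : (κ ∘ₖ Kernel.const Unit μ) () = κ ∘ₘ μ := Kernel.comp_apply _ _ _
  rw [← hc, Kernel.integral_comp (by rwa [hc])]
  rw [Kernel.const_apply]
  simp only [charFun_apply_real]
  rfl

/-! ### Weighted sums with reciprocal partial sums -/

lemma tendsto_log_add_one : Tendsto (fun n : ℕ => Real.log ((n : ℝ) + 1)) atTop atTop :=
  Real.tendsto_log_atTop.comp (tendsto_atTop_add_const_right _ _ tendsto_natCast_atTop_atTop)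

section WeightedSums

variable {S w : ℕ → ℝ} {a : ℝ}

lemma eq_add_sum_range (hS : ∀ n, S (n + 1) = S n + w n) (n : ℕ) :
    S n = S 0 + ∑ k ∈ Finset.range n, w k := by
  induction n with
  | zero => simp
  | succ n ih => rw [hS, ih, Finset.sum_range_succ]; ring

lemma exists_linear_lower_bound (hpos : ∀ n, 0 < S n) (ha : 0 < a)
    (hlim : Tendsto (fun n : ℕ => S n / (n + 1)) atTop (𝓝 a)) :
    ∃ δ > 0, ∀ n : ℕ, δ * (n + 1) ≤ S n := by
  obtain ⟨N, hN⟩ := eventually_atTop.1 (hlim.eventually_const_lt (half_lt_self ha))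
  obtain ⟨i, -, hi⟩ := Finset.exists_min_image (Finset.range (N + 1))
    (fun n : ℕ => S n / (n + 1)) ⟨0, by simp⟩
  have hi0 : 0 < S i / ((i : ℝ) + 1) := div_pos (hpos i) (by positivity)
  refine ⟨min (a / 2) (S i / (i + 1)), lt_min (half_pos ha) hi0, fun n => ?_⟩
  rw [← le_div_iff₀ (by positivity)]
  rcases le_total N n with h | h
  · exact (min_le_left _ _).trans (hN n h).le
  · exact (min_le_right _ _).trans (hi n (Finset.mem_range.2 (by omega)))

/-- Summation by parts for weighted sums whose weights are reciprocals of partial sums. -/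
lemma sum_div_partial_sum (hpos : ∀ n, 0 < S n) (hS : ∀ n, S (n + 1) = S n + w n) (y : ℕ → ℝ)
    (n : ℕ) :
    ∑ k ∈ Finset.range n, y k / S (k + 1) = (∑ k ∈ Finset.range n, y k) / S n +
      ∑ k ∈ Finset.range n, (∑ j ∈ Finset.range k, y j) / S k * (w k / S (k + 1)) := by
  induction n with
  | zero => simp
  | succ n ih =>
    rw [Finset.sum_range_succ, ih, Finset.sum_range_succ _ n, Finset.sum_range_succ _ n]
    have h0 := (hpos n).ne'
    have h1 := (hpos (n + 1)).ne'
    have h2 : w n = S (n + 1) - S n := by rw [hS]; ring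
    rw [h2]
    field_simp
    ring

lemma inv_mul_inv_le {δ : ℝ} (hδ : 0 < δ) (h : ∀ n : ℕ, δ * (n + 1) ≤ S n) (k : ℕ) :
    1 / (S k * S (k + 1)) ≤ 1 / δ ^ 2 * (1 / ((k : ℝ) + 1) ^ 2) := by
  have e1 : 1 / (S k * S (k + 1)) = 1 / S (k + 1) * (1 / S k) := by
    rw [one_div_mul_one_div, mul_comm]
  rw [e1, ← one_div_pow, ← one_div_pow, ← mul_pow, sq]
  have h1 : 1 / S k ≤ 1 / δ * (1 / ((k : ℝ) + 1)) := by
    rw [one_div_mul_one_div]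
    exact one_div_le_one_div_of_le (by positivity) (h k)
  have h2 : 1 / S (k + 1) ≤ 1 / δ * (1 / ((k : ℝ) + 1)) := by
    rw [one_div_mul_one_div]
    refine one_div_le_one_div_of_le (by positivity) (le_trans ?_ (h (k + 1)))
    push_cast
    nlinarith
  have h3 : 0 ≤ 1 / S k := one_div_nonneg.2 (le_trans (by positivity) (h k))
  have h4 : 0 ≤ 1 / δ * (1 / ((k : ℝ) + 1)) := by positivity
  have h5 : 0 ≤ 1 / S (k + 1) := one_div_nonneg.2 (le_trans (by positivity) (h (k + 1)))
  exact mul_le_mul h2 h1 h3 h4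

/-- The probabilities `wₖ / Sₖ₊₁` sum up to `ln n` up to a bounded error: they are the increments of
`ln Sₖ` up to an error of the order `wₖ² / k²`. -/
lemma exists_sum_div_sub_log_le (hpos : ∀ n, 0 < S n) (hS : ∀ n, S (n + 1) = S n + w n)
    (hw : ∀ n, 0 ≤ w n) (ha : 0 < a) (hlim : Tendsto (fun n : ℕ => S n / (n + 1)) atTop (𝓝 a))
    (hsq : Summable fun k : ℕ => w k ^ 2 / ((k : ℝ) + 1) ^ 2) :
    ∃ C, ∀ n : ℕ, |∑ k ∈ Finset.range n, w k / S (k + 1) - Real.log (n + 1)| ≤ C := by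
  obtain ⟨δ, hδ, hl⟩ := exists_linear_lower_bound hpos ha hlim
  have hterm : ∀ k, |w k / S (k + 1) - (Real.log (S (k + 1)) - Real.log (S k))| ≤
      1 / δ ^ 2 * (w k ^ 2 / ((k : ℝ) + 1) ^ 2) := by
    intro k
    have h0 := hpos k
    have h1 := hpos (k + 1)
    have hww := hw k
    have lo : w k / S (k + 1) ≤ Real.log (S (k + 1)) - Real.log (S k) := by
      have := Real.one_sub_inv_le_log_of_pos (div_pos h1 h0)
      rw [Real.log_div h1.ne' h0.ne'] at this
      refine le_trans (le_of_eq ?_) this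
      rw [inv_div, eq_sub_iff_add_eq, ← add_div, hS, add_comm, div_self]
      rw [← hS]; exact h1.ne'
    have up : Real.log (S (k + 1)) - Real.log (S k) ≤ w k / S k := by
      have := Real.log_le_sub_one_of_pos (div_pos h1 h0)
      rw [Real.log_div h1.ne' h0.ne'] at this
      refine this.trans (le_of_eq ?_)
      rw [hS, add_div, div_self h0.ne']; ring
    have e : w k / S k - w k / S (k + 1) = w k ^ 2 * (1 / (S k * S (k + 1))) := by
      have : w k = S (k + 1) - S k := by rw [hS]; ring
      rw [this]
      field_simp
    have b := mul_le_mul_of_nonneg_left (inv_mul_inv_le hδ hl k) (sq_nonneg (w k))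
    have e2 : w k ^ 2 * (1 / δ ^ 2 * (1 / ((k : ℝ) + 1) ^ 2)) =
        1 / δ ^ 2 * (w k ^ 2 / ((k : ℝ) + 1) ^ 2) := by ring
    rw [abs_le]
    constructor <;> linarith
  have hlog : Tendsto (fun n : ℕ => Real.log (S n) - Real.log (n + 1)) atTop (𝓝 (Real.log a)) := by
    refine (hlim.log ha.ne').congr fun n => ?_
    rw [Real.log_div (hpos n).ne' (by positivity)]
  obtain ⟨C, hC⟩ := (Metric.isBounded_range_of_tendsto _ hlog).exists_norm_le
  refine ⟨1 / δ ^ 2 * ∑' k : ℕ, w k ^ 2 / ((k : ℝ) + 1) ^ 2 + (C + |Real.log (S 0)|), fun n => ?_⟩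
  have e : ∑ k ∈ Finset.range n, w k / S (k + 1) - Real.log (n + 1) =
      ∑ k ∈ Finset.range n, (w k / S (k + 1) - (Real.log (S (k + 1)) - Real.log (S k))) +
        ((Real.log (S n) - Real.log (n + 1)) - Real.log (S 0)) := by
    rw [Finset.sum_sub_distrib, Finset.sum_range_sub fun k => Real.log (S k)]
    ring
  rw [e]
  refine (abs_add_le _ _).trans (add_le_add ?_ ?_)
  · refine (Finset.abs_sum_le_sum_abs _ _).trans ((Finset.sum_le_sum fun k _ => hterm k).trans ?_)
    rw [← Finset.mul_sum]
    exact mul_le_mul_of_nonneg_left (hsq.sum_le_tsum _ fun k _ => by positivity) (by positivity)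
  · exact (abs_sub _ _).trans (add_le_add_left (hC _ ⟨n, rfl⟩) _)

lemma tendsto_sum_div_div_log (hpos : ∀ n, 0 < S n) (hS : ∀ n, S (n + 1) = S n + w n)
    (hw : ∀ n, 0 ≤ w n) (ha : 0 < a) (hlim : Tendsto (fun n : ℕ => S n / (n + 1)) atTop (𝓝 a))
    (hsq : Summable fun k : ℕ => w k ^ 2 / ((k : ℝ) + 1) ^ 2) :
    Tendsto (fun n : ℕ => (∑ k ∈ Finset.range n, w k / S (k + 1)) / Real.log (n + 1)) atTop
      (𝓝 1) := by
  obtain ⟨C, hC⟩ := exists_sum_div_sub_log_le hpos hS hw ha hlim hsq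
  have h0 : Tendsto (fun n : ℕ => (∑ k ∈ Finset.range n, w k / S (k + 1) - Real.log (n + 1)) /
      Real.log (n + 1)) atTop (𝓝 0) := by
    refine squeeze_zero_norm' (a := fun n : ℕ => C / Real.log (n + 1)) ?_
      (tendsto_log_add_one.const_div_atTop C)
    filter_upwards [tendsto_log_add_one.eventually_gt_atTop 0] with n hn
    rw [norm_div, Real.norm_eq_abs, Real.norm_of_nonneg hn.le]
    exact div_le_div_of_nonneg_right (hC n) hn.le
  have := h0.add_const 1
  rw [zero_add] at this
  refine this.congr' ?_
  filter_upwards [tendsto_log_add_one.eventually_gt_atTop 0] with n hn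
  rw [sub_div, div_self hn.ne', sub_add_cancel]

/-- By parts, the weighted sum is the sum of the `Yₖ / Sₖ * (wₖ / Sₖ₊₁)` up to a bounded term, and
`Yₖ / Sₖ`, where `Yₖ = y₀ + … + yₖ₋₁`, tends to zero, while the sum of the `wₖ / Sₖ₊₁` is asymptotic
to `ln n`. -/
lemma tendsto_centered_sum_div_log (hpos : ∀ n, 0 < S n) (hS : ∀ n, S (n + 1) = S n + w n)
    (hw : ∀ n, 0 ≤ w n) (ha : 0 < a) (hlim : Tendsto (fun n : ℕ => S n / (n + 1)) atTop (𝓝 a))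
    (hsq : Summable fun k : ℕ => w k ^ 2 / ((k : ℝ) + 1) ^ 2) {y : ℕ → ℝ}
    (hy : Tendsto (fun n : ℕ => (∑ k ∈ Finset.range n, y k) / ((n : ℝ) + 1)) atTop (𝓝 0)) :
    Tendsto (fun n : ℕ => (∑ k ∈ Finset.range n, y k / S (k + 1)) / Real.log (n + 1)) atTop
      (𝓝 0) := by
  have hY : Tendsto (fun n : ℕ => (∑ k ∈ Finset.range n, y k) / S n) atTop (𝓝 0) := by
    have := hy.div hlim ha.ne'
    rw [zero_div] at this
    refine this.congr fun n => ?_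
    exact div_div_div_cancel_right₀ (by positivity) _ _
  have hlg := tendsto_sum_div_div_log hpos hS hw ha hlim hsq
  have hp0 : ∀ k, 0 ≤ w k / S (k + 1) := fun k => div_nonneg (hw k) (hpos _).le
  have hdiv : Tendsto (fun n : ℕ => ∑ k ∈ Finset.range n, w k / S (k + 1)) atTop atTop := by
    refine (hlg.pos_mul_atTop one_pos tendsto_log_add_one).congr' ?_
    filter_upwards [tendsto_log_add_one.eventually_gt_atTop 0] with n hn
    exact div_mul_cancel₀ _ hn.ne'
  have hO : (fun k => (∑ j ∈ Finset.range k, y j) / S k * (w k / S (k + 1))) =o[atTop]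
      fun k => w k / S (k + 1) := by
    have := ((Asymptotics.isLittleO_one_iff ℝ).2 hY).mul_isBigO
      (Asymptotics.isBigO_refl (fun k => w k / S (k + 1)) atTop)
    simpa using this
  have hO' := (hO.sum_range hp0 hdiv).tendsto_div_nhds_zero
  have h2 := hO'.mul hlg
  rw [zero_mul] at h2
  have h3 : Tendsto (fun n : ℕ => (∑ k ∈ Finset.range n, y k) / S n / Real.log (n + 1)) atTop
      (𝓝 0) := hY.div_atTop tendsto_log_add_one
  have h4 := h3.add h2
  rw [add_zero] at h4
  refine h4.congr' ?_
  filter_upwards [hdiv.eventually_gt_atTop 0] with n hn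
  rw [sum_div_partial_sum hpos hS y, div_mul_div_cancel₀ hn.ne', add_div]

/-- If `x₀ + … + xₙ₋₁ ∼ n * x`, then the weighted sums of the `xₖ` with the weights `1 / Sₖ₊₁` grow
like `(x / a) * ln n`. -/
lemma tendsto_weighted_sum_div_log (hpos : ∀ n, 0 < S n) (hS : ∀ n, S (n + 1) = S n + w n)
    (hw : ∀ n, 0 ≤ w n) (ha : 0 < a) (hlim : Tendsto (fun n : ℕ => S n / (n + 1)) atTop (𝓝 a))
    (hsq : Summable fun k : ℕ => w k ^ 2 / ((k : ℝ) + 1) ^ 2) {x : ℕ → ℝ} {c : ℝ}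
    (hx : Tendsto (fun n : ℕ => (∑ k ∈ Finset.range n, x k) / ((n : ℝ) + 1)) atTop (𝓝 c)) :
    Tendsto (fun n : ℕ => (∑ k ∈ Finset.range n, x k / S (k + 1)) / Real.log (n + 1)) atTop
      (𝓝 (c / a)) := by
  have hy : Tendsto (fun n : ℕ => (∑ k ∈ Finset.range n, (x k - c / a * w k)) / ((n : ℝ) + 1))
      atTop (𝓝 0) := by
    have h0 : Tendsto (fun n : ℕ => c / a * S 0 * (1 / ((n : ℝ) + 1))) atTop (𝓝 0) := by
      simpa using (tendsto_one_div_add_atTop_nhds_zero_nat (𝕜 := ℝ)).const_mul (c / a * S 0)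
    have := (hx.sub (hlim.const_mul (c / a))).add h0
    rw [div_mul_cancel₀ _ ha.ne', sub_self, zero_add] at this
    refine this.congr fun n => ?_
    rw [Finset.sum_sub_distrib, ← Finset.mul_sum, eq_add_sum_range hS n]
    ring
  have h1 := tendsto_centered_sum_div_log hpos hS hw ha hlim hsq hy
  have h2 := h1.add ((tendsto_sum_div_div_log hpos hS hw ha hlim hsq).const_mul (c / a))
  rw [zero_add, mul_one] at h2
  refine h2.congr fun n => ?_
  rw [← mul_div_assoc, ← add_div, Finset.mul_sum, ← Finset.sum_add_distrib]
  congr 1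
  exact Finset.sum_congr rfl fun k _ => by ring

/-- Weighted sums of a sequence with small partial sums stay bounded. -/
lemma exists_centered_sum_le (hpos : ∀ n, 0 < S n) (hS : ∀ n, S (n + 1) = S n + w n)
    (hw : ∀ n, 0 ≤ w n) (ha : 0 < a) (hlim : Tendsto (fun n : ℕ => S n / (n + 1)) atTop (𝓝 a))
    {y : ℕ → ℝ}
    (hy : Tendsto (fun n : ℕ => (∑ k ∈ Finset.range n, y k) / ((n : ℝ) + 1)) atTop (𝓝 0))
    (hsum : Summable fun k : ℕ => |∑ j ∈ Finset.range k, y j| * w k / ((k : ℝ) + 1) ^ 2) :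
    ∃ C, ∀ n : ℕ, |∑ k ∈ Finset.range n, y k / S (k + 1)| ≤ C := by
  obtain ⟨δ, hδ, hl⟩ := exists_linear_lower_bound hpos ha hlim
  have hY : Tendsto (fun n : ℕ => (∑ k ∈ Finset.range n, y k) / S n) atTop (𝓝 (0 / a)) := by
    refine (hy.div hlim ha.ne').congr fun n => ?_
    exact div_div_div_cancel_right₀ (by positivity) _ _
  obtain ⟨C, hC⟩ := (Metric.isBounded_range_of_tendsto _ hY).exists_norm_le
  refine ⟨C + 1 / δ ^ 2 * ∑' k : ℕ, |∑ j ∈ Finset.range k, y j| * w k / ((k : ℝ) + 1) ^ 2,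
    fun n => ?_⟩
  rw [sum_div_partial_sum hpos hS]
  refine (abs_add_le _ _).trans (add_le_add (hC _ ⟨n, rfl⟩) ?_)
  refine (Finset.abs_sum_le_sum_abs _ _).trans ?_
  refine (Finset.sum_le_sum (g := fun k : ℕ => 1 / δ ^ 2 *
    (|∑ j ∈ Finset.range k, y j| * w k / ((k : ℝ) + 1) ^ 2)) fun k _ => ?_).trans ?_
  · have b := mul_le_mul_of_nonneg_left (inv_mul_inv_le hδ hl k)
      (mul_nonneg (abs_nonneg (∑ j ∈ Finset.range k, y j)) (hw k))
    rw [abs_mul, abs_div, abs_div, abs_of_pos (hpos k), abs_of_pos (hpos (k + 1)),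
      abs_of_nonneg (hw k)]
    calc _ = |∑ j ∈ Finset.range k, y j| * w k * (1 / (S k * S (k + 1))) := by field_simp
      _ ≤ _ := b
      _ = _ := by ring
  · rw [← Finset.mul_sum]
    refine mul_le_mul_of_nonneg_left (hsum.sum_le_tsum _ fun k _ => ?_) (by positivity)
    have := hw k
    positivity

end WeightedSums

/-! ### Estimates of characteristic functions -/

section ComplexEstimates

lemma norm_prod_sub_prod_le {ι : Type*} (s : Finset ι) (f g : ι → ℂ) (hf : ∀ i, ‖f i‖ ≤ 1)
    (hg : ∀ i, ‖g i‖ ≤ 1) : ‖∏ i ∈ s, f i - ∏ i ∈ s, g i‖ ≤ ∑ i ∈ s, ‖f i - g i‖ := by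
  classical
  induction s using Finset.induction_on with
  | empty => simp
  | insert i s hi ih =>
    rw [Finset.prod_insert hi, Finset.prod_insert hi, Finset.sum_insert hi]
    have hp : ‖∏ j ∈ s, f j‖ ≤ 1 := by
      rw [norm_prod]; exact Finset.prod_le_one (fun _ _ => norm_nonneg _) fun j _ => hf j
    calc ‖f i * ∏ j ∈ s, f j - g i * ∏ j ∈ s, g j‖
        = ‖(f i - g i) * ∏ j ∈ s, f j + g i * (∏ j ∈ s, f j - ∏ j ∈ s, g j)‖ := by ring_nf
      _ ≤ ‖f i - g i‖ * ‖∏ j ∈ s, f j‖ + ‖g i‖ * ‖∏ j ∈ s, f j - ∏ j ∈ s, g j‖ := by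
        refine (norm_add_le _ _).trans ?_
        rw [norm_mul, norm_mul]
      _ ≤ ‖f i - g i‖ * 1 + 1 * ∑ j ∈ s, ‖f j - g j‖ := by
        gcongr
        exact hg i
      _ = _ := by ring

lemma norm_one_add_sub_exp_le {z : ℂ} (hz : z.re ≤ 0) : ‖1 + z - Complex.exp z‖ ≤ 3 * ‖z‖ ^ 2 := by
  rcases le_total ‖z‖ 1 with h | h
  · have := Complex.norm_exp_sub_one_sub_id_le h
    rw [← norm_neg, show -(1 + z - Complex.exp z) = Complex.exp z - 1 - z by ring]
    nlinarith [sq_nonneg ‖z‖]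
  · have h1 : ‖Complex.exp z‖ ≤ 1 := by
      rw [Complex.norm_exp]; exact Real.exp_le_one_iff.2 hz
    have h2 := norm_sub_le (1 + z) (Complex.exp z)
    have h3 := norm_add_le 1 z
    rw [norm_one] at h3
    nlinarith

lemma norm_exp_mul_I_sub_taylor_le (x : ℝ) :
    ‖Complex.exp (x * Complex.I) - 1 - x * Complex.I + x ^ 2 / 2‖ ≤ 4 * (x ^ 2 * min 1 |x|) := by
  rcases le_total |x| 1 with h | h
  · have hn : ‖(x : ℂ) * Complex.I‖ = |x| := by simp
    have := Complex.exp_bound (x := x * Complex.I) (by rw [hn]; exact h) (n := 3) (by norm_num)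
    rw [hn] at this
    have e : Complex.exp (x * Complex.I) - ∑ m ∈ Finset.range 3,
        ((x : ℂ) * Complex.I) ^ m / (m.factorial : ℂ) =
        Complex.exp (x * Complex.I) - 1 - x * Complex.I + x ^ 2 / 2 := by
      simp [Finset.sum_range_succ, mul_pow]
      ring
    rw [e] at this
    rw [min_eq_right h]
    refine this.trans ?_
    have h3 : |x| ^ 3 = x ^ 2 * |x| := by rw [pow_succ, sq_abs]
    rw [h3]
    have : 0 ≤ x ^ 2 * |x| := by positivity
    norm_num [Nat.factorial]
    linarith
  · rw [min_eq_left h]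
    have h1 : ‖Complex.exp (x * Complex.I)‖ = 1 := Complex.norm_exp_ofReal_mul_I x
    have h2 : ‖(x : ℂ) * Complex.I‖ = |x| := by simp
    have h3 : ‖(x : ℂ) ^ 2 / 2‖ = x ^ 2 / 2 := by simp
    have a1 := norm_add_le (Complex.exp (x * Complex.I) - 1 - x * Complex.I) ((x : ℂ) ^ 2 / 2)
    have a2 := norm_sub_le (Complex.exp (x * Complex.I) - 1) (x * Complex.I)
    have a3 := norm_sub_le (Complex.exp (x * Complex.I)) 1
    rw [norm_one] at a3
    have : |x| ^ 2 = x ^ 2 := sq_abs x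
    nlinarith

end ComplexEstimates

section CharFun

variable {ν : Measure ℝ}

lemma integrable_sq_mul_min (h : Integrable (fun x : ℝ => x ^ 2) ν) {τ : ℝ} (hτ : 0 ≤ τ) :
    Integrable (fun x : ℝ => x ^ 2 * min 1 (τ * |x|)) ν := by
  refine h.mono' (by fun_prop) (ae_of_all _ fun x => ?_)
  rw [Real.norm_of_nonneg (by positivity)]
  exact mul_le_of_le_one_right (sq_nonneg x) (min_le_left _ _)

variable [IsProbabilityMeasure ν]

lemma integrable_exp_mul_I (t : ℝ) :
    Integrable (fun x : ℝ => Complex.exp (t * x * Complex.I)) ν := by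
  refine Integrable.of_bound (by fun_prop) 1 (ae_of_all _ fun x => ?_)
  rw [← Complex.ofReal_mul, Complex.norm_exp_ofReal_mul_I]

lemma sq_integral_abs_le (h : Integrable (fun x : ℝ => x ^ 2) ν) :
    (∫ x, |x| ∂ν) ^ 2 ≤ ∫ x, x ^ 2 ∂ν := by
  have hm : MemLp (fun x : ℝ => |x|) 2 ν :=
    (memLp_two_iff_integrable_sq (by fun_prop)).2 (by simpa using h)
  have h1 := variance_nonneg (fun x : ℝ => |x|) ν
  rw [variance_eq_sub hm] at h1
  simp only [Pi.pow_apply, sq_abs] at h1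
  linarith

lemma integrable_id_of_sq (h : Integrable (fun x : ℝ => x ^ 2) ν) :
    Integrable (fun x : ℝ => x) ν :=
  ((memLp_two_iff_integrable_sq (f := fun x : ℝ => x) (by fun_prop)).2 h).integrable
    one_le_two

lemma norm_charFun_sub_one_sq_le (h : Integrable (fun x : ℝ => x ^ 2) ν) (t : ℝ) :
    ‖charFun ν t - 1‖ ^ 2 ≤ t ^ 2 * ∫ x, x ^ 2 ∂ν := by
  have hi : Integrable (fun x : ℝ => Complex.exp (t * x * Complex.I)) ν := integrable_exp_mul_I t
  have e : charFun ν t - 1 = ∫ x, (Complex.exp (t * x * Complex.I) - 1) ∂ν := by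
    rw [integral_sub hi (integrable_const _), charFun_apply_real]
    simp
  have h1 : ‖charFun ν t - 1‖ ≤ |t| * ∫ x, |x| ∂ν := by
    rw [e, ← integral_const_mul]
    refine norm_integral_le_of_norm_le ((integrable_id_of_sq h).abs.const_mul _)
      (ae_of_all _ fun x => ?_)
    have := Real.norm_exp_I_mul_ofReal_sub_one_le (x := t * x)
    rw [Real.norm_eq_abs, abs_mul] at this
    rwa [mul_comm (_ * _) Complex.I, ← Complex.ofReal_mul]
  calc ‖charFun ν t - 1‖ ^ 2 ≤ (|t| * ∫ x, |x| ∂ν) ^ 2 := by gcongr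
    _ = t ^ 2 * (∫ x, |x| ∂ν) ^ 2 := by rw [mul_pow, sq_abs]
    _ ≤ _ := mul_le_mul_of_nonneg_left (sq_integral_abs_le h) (sq_nonneg t)

/-- The second order expansion of a characteristic function, with a remainder that is uniformly
controlled by a truncated second moment. -/
lemma norm_charFun_sub_taylor_le (h : Integrable (fun x : ℝ => x ^ 2) ν) (t : ℝ) :
    ‖charFun ν t - 1 - t * (∫ x, x ∂ν : ℝ) * Complex.I + t ^ 2 / 2 * (∫ x, x ^ 2 ∂ν : ℝ)‖ ≤
      4 * t ^ 2 * ∫ x, x ^ 2 * min 1 (|t| * |x|) ∂ν := by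
  have hi : Integrable (fun x : ℝ => Complex.exp (t * x * Complex.I)) ν := integrable_exp_mul_I t
  have hx : Integrable (fun x : ℝ => (t : ℂ) * x * Complex.I) ν :=
    ((integrable_id_of_sq h).ofReal.const_mul _).mul_const _
  have hx2 : Integrable (fun x : ℝ => (t : ℂ) ^ 2 / 2 * (x ^ 2 : ℝ)) ν := h.ofReal.const_mul _
  have e : charFun ν t - 1 - t * (∫ x, x ∂ν : ℝ) * Complex.I + t ^ 2 / 2 * (∫ x, x ^ 2 ∂ν : ℝ) =
      ∫ x, (Complex.exp (t * x * Complex.I) - 1 - t * x * Complex.I +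
        t ^ 2 / 2 * (x ^ 2 : ℝ)) ∂ν := by
    have c1 : ∫ x, (x : ℂ) ∂ν = (∫ x, x ∂ν : ℝ) := integral_ofReal
    have c2 : ∫ x, ((x ^ 2 : ℝ) : ℂ) ∂ν = (∫ x, x ^ 2 ∂ν : ℝ) := integral_ofReal
    have hi1 : Integrable (fun x : ℝ => Complex.exp (t * x * Complex.I) - 1) ν :=
      hi.sub (integrable_const _)
    have hi2 : Integrable
        (fun x : ℝ => Complex.exp (t * x * Complex.I) - 1 - t * x * Complex.I) ν := hi1.sub hx
    rw [integral_add hi2 hx2, integral_sub hi1 hx, integral_sub hi (integrable_const _),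
      integral_mul_const, integral_const_mul, integral_const_mul, c1, c2, charFun_apply_real]
    simp
  rw [e, ← integral_const_mul]
  refine norm_integral_le_of_norm_le ((integrable_sq_mul_min h (abs_nonneg t)).const_mul _)
    (ae_of_all _ fun x => ?_)
  have := norm_exp_mul_I_sub_taylor_le (t * x)
  rw [abs_mul] at this
  refine le_trans (le_of_eq ?_) (this.trans (le_of_eq (by ring)))
  push_cast
  congr 1
  ring

end CharFun

/-- The central limit theorem for given blocks: convergence of the characteristic function of the
mixture `ν * ∏ (1 - pₖ + pₖ νₖ)`, where `pₖ = wₖ / Sₖ₊₁`, from the logarithmic asymptotics of the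
weighted sums of the moments of the `νₖ`. -/
lemma tendsto_prod_charFun {S w : ℕ → ℝ} (hpos : ∀ n, 0 < S n) (hS : ∀ n, S (n + 1) = S n + w n)
    (hw : ∀ n, 0 ≤ w n) {a : ℝ} (ha : 0 < a)
    (hlim : Tendsto (fun n : ℕ => S n / (n + 1)) atTop (𝓝 a))
    (ν₀ : Measure ℝ) [IsProbabilityMeasure ν₀] (ν : ℕ → Measure ℝ)
    [∀ k, IsProbabilityMeasure (ν k)] (hν : ∀ k, Integrable (fun x : ℝ => x ^ 2) (ν k))
    {c v C : ℝ}
    (hmean : ∀ n : ℕ, |(∑ k ∈ Finset.range n, w k / S (k + 1) * ∫ x, x ∂ν k) -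
      c * Real.log (n + 1)| ≤ C)
    (hvar : Tendsto (fun n : ℕ => (∑ k ∈ Finset.range n, w k / S (k + 1) * ∫ x, x ^ 2 ∂ν k) /
      Real.log (n + 1)) atTop (𝓝 v))
    (hsq : Summable fun k : ℕ => w k ^ 2 * (∫ x, x ^ 2 ∂ν k) / ((k : ℝ) + 1) ^ 2)
    {r : ℕ → ℝ} (hr : Tendsto r atTop (𝓝 0))
    (htrunc : ∀ j : ℕ, Tendsto (fun n : ℕ => (∑ k ∈ Finset.range n, w k / S (k + 1) *
      ∫ x, x ^ 2 * min 1 (1 / ((j : ℝ) + 1) * |x|) ∂ν k) / Real.log (n + 1)) atTop (𝓝 (r j)))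
    (s : ℝ) :
    Tendsto (fun n : ℕ =>
      Complex.exp (-((s / √(Real.log (n + 1)) * (c * Real.log (n + 1)) : ℝ) * Complex.I)) *
        (charFun ν₀ (s / √(Real.log (n + 1))) * ∏ k ∈ Finset.range n,
          (1 + ((w k / S (k + 1) : ℝ) : ℂ) *
            (charFun (ν k) (s / √(Real.log (n + 1))) - 1)))) atTop
      (𝓝 (Complex.exp (-(v * s ^ 2 / 2 : ℝ)))) := by
  set t : ℕ → ℝ := fun n => s / √(Real.log (n + 1)) with ht
  set p : ℕ → ℝ := fun k => w k / S (k + 1) with hp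
  have hp0 : ∀ k, 0 ≤ p k := fun k => div_nonneg (hw k) (hpos _).le
  have hp1 : ∀ k, p k ≤ 1 := fun k => by
    refine (div_le_one (hpos _)).2 ?_
    rw [hS]; linarith [hpos k]
  have hq0 : ∀ k, 0 ≤ ∫ x, x ^ 2 ∂ν k := fun k => integral_nonneg fun x => sq_nonneg x
  have ht0 : Tendsto t atTop (𝓝 0) :=
    (Real.tendsto_sqrt_atTop.comp tendsto_log_add_one).const_div_atTop s
  have ht2 : ∀ᶠ n : ℕ in atTop, t n ^ 2 = s ^ 2 / Real.log (n + 1) := by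
    filter_upwards [tendsto_log_add_one.eventually_gt_atTop 0] with n hn
    rw [ht, div_pow, Real.sq_sqrt hn.le]
  set z : ℕ → ℕ → ℂ := fun n k => (p k : ℂ) * (charFun (ν k) (t n) - 1) with hz
  have hzre : ∀ n k, (z n k).re ≤ 0 := by
    intro n k
    rw [hz, Complex.re_ofReal_mul, Complex.sub_re, Complex.one_re]
    have h1 := (Complex.re_le_norm _).trans (norm_charFun_le_one (μ := ν k) (t := t n))
    exact mul_nonpos_of_nonneg_of_nonpos (hp0 k) (by linarith)
  have hz1 : ∀ n k, ‖1 + z n k‖ ≤ 1 := by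
    intro n k
    have e : 1 + z n k = ((1 - p k : ℝ) : ℂ) + (p k : ℂ) * charFun (ν k) (t n) := by
      rw [hz]; push_cast; ring
    rw [e]
    refine (norm_add_le _ _).trans ?_
    rw [norm_mul, Complex.norm_real, Complex.norm_real, Real.norm_of_nonneg (hp0 k),
      Real.norm_of_nonneg (sub_nonneg.2 (hp1 k))]
    have := mul_le_mul_of_nonneg_left (norm_charFun_le_one (μ := ν k) (t := t n)) (hp0 k)
    linarith
  -- the product is replaced by an exponential, with an error of the order of `t ^ 2`
  obtain ⟨δ, hδ, hl⟩ := exists_linear_lower_bound hpos ha hlim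
  set K : ℝ := 3 * (1 / δ ^ 2 * ∑' k : ℕ, w k ^ 2 * (∫ x, x ^ 2 ∂ν k) / ((k : ℝ) + 1) ^ 2) with hK
  have hprod : ∀ n, ‖∏ k ∈ Finset.range n, (1 + z n k) -
      Complex.exp (∑ k ∈ Finset.range n, z n k)‖ ≤ t n ^ 2 * K := by
    intro n
    rw [Complex.exp_sum]
    refine (norm_prod_sub_prod_le _ _ _ (hz1 n) fun k => ?_).trans ?_
    · rw [Complex.norm_exp]; exact Real.exp_le_one_iff.2 (hzre n k)
    have hb : ∀ k, ‖1 + z n k - Complex.exp (z n k)‖ ≤ t n ^ 2 * (3 * (1 / δ ^ 2 *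
        (w k ^ 2 * (∫ x, x ^ 2 ∂ν k) / ((k : ℝ) + 1) ^ 2))) := by
      intro k
      refine (norm_one_add_sub_exp_le (hzre n k)).trans ?_
      have h1 : ‖z n k‖ ^ 2 ≤ p k ^ 2 * (t n ^ 2 * ∫ x, x ^ 2 ∂ν k) := by
        rw [hz, norm_mul, Complex.norm_real, Real.norm_of_nonneg (hp0 k), mul_pow]
        exact mul_le_mul_of_nonneg_left (norm_charFun_sub_one_sq_le (hν k) _) (sq_nonneg _)
      have h2 : p k ^ 2 ≤ 1 / δ ^ 2 * (w k ^ 2 / ((k : ℝ) + 1) ^ 2) := by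
        have h3 : p k ≤ 1 / δ * (w k / ((k : ℝ) + 1)) := by
          have h4 : p k ≤ w k / (δ * (k + 1)) := by
            refine div_le_div_of_nonneg_left (hw k) (by positivity) (le_trans ?_ (hl (k + 1)))
            push_cast
            nlinarith
          refine h4.trans (le_of_eq ?_)
          field_simp
        calc p k ^ 2 ≤ (1 / δ * (w k / ((k : ℝ) + 1))) ^ 2 := by gcongr; exact hp0 k
          _ = _ := by rw [mul_pow, one_div_pow, div_pow]
      have h3 := mul_le_mul_of_nonneg_right h2
        (mul_nonneg (sq_nonneg (t n)) (hq0 k))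
      calc 3 * ‖z n k‖ ^ 2 ≤ 3 * (1 / δ ^ 2 * (w k ^ 2 / ((k : ℝ) + 1) ^ 2) *
            (t n ^ 2 * ∫ x, x ^ 2 ∂ν k)) := by linarith
        _ = _ := by ring
    refine (Finset.sum_le_sum fun k _ => hb k).trans ?_
    rw [← Finset.mul_sum, ← Finset.mul_sum, ← Finset.mul_sum, hK]
    have := hsq.sum_le_tsum (Finset.range n) fun k _ =>
      div_nonneg (mul_nonneg (sq_nonneg (w k)) (hq0 k)) (sq_nonneg ((k : ℝ) + 1))
    gcongr
  -- the exponent converges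
  have hrem : Tendsto (fun n => ∑ k ∈ Finset.range n, (p k : ℂ) * (charFun (ν k) (t n) - 1 -
      t n * (∫ x, x ∂ν k : ℝ) * Complex.I + t n ^ 2 / 2 * (∫ x, x ^ 2 ∂ν k : ℝ))) atTop (𝓝 0) := by
    have hbound : ∀ n, ‖∑ k ∈ Finset.range n, (p k : ℂ) * (charFun (ν k) (t n) - 1 -
        t n * (∫ x, x ∂ν k : ℝ) * Complex.I + t n ^ 2 / 2 * (∫ x, x ^ 2 ∂ν k : ℝ))‖ ≤
        4 * t n ^ 2 * ∑ k ∈ Finset.range n, p k * ∫ x, x ^ 2 * min 1 (|t n| * |x|) ∂ν k := by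
      intro n
      refine (norm_sum_le _ _).trans ?_
      rw [Finset.mul_sum]
      refine Finset.sum_le_sum fun k _ => ?_
      rw [norm_mul, Complex.norm_real, Real.norm_of_nonneg (hp0 k), mul_left_comm]
      exact mul_le_mul_of_nonneg_left (norm_charFun_sub_taylor_le (hν k) _) (hp0 k)
    rw [Metric.tendsto_atTop']
    intro ε hε
    have h4 : Tendsto (fun j => 4 * s ^ 2 * r j) atTop (𝓝 0) := by
      simpa using hr.const_mul (4 * s ^ 2)
    obtain ⟨j, hj⟩ := (h4.eventually_lt_const hε).exists
    have h5 := ((htrunc j).const_mul (4 * s ^ 2)).eventually_lt_const hj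
    have h6 : ∀ᶠ n in atTop, |t n| < 1 / ((j : ℝ) + 1) := by
      have := ht0.abs
      rw [abs_zero] at this
      exact this.eventually_lt_const (by positivity)
    obtain ⟨N, hN⟩ := eventually_atTop.1 ((h5.and h6).and ht2)
    refine ⟨N, fun n hn => ?_⟩
    obtain ⟨⟨h5, h6⟩, h7⟩ := hN n hn.le
    rw [dist_zero_right]
    refine ((hbound n).trans ?_).trans_lt h5
    have h8 : ∑ k ∈ Finset.range n, p k * ∫ x, x ^ 2 * min 1 (|t n| * |x|) ∂ν k ≤
        ∑ k ∈ Finset.range n, p k * ∫ x, x ^ 2 * min 1 (1 / ((j : ℝ) + 1) * |x|) ∂ν k := by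
      refine Finset.sum_le_sum fun k _ => mul_le_mul_of_nonneg_left ?_ (hp0 k)
      refine integral_mono (integrable_sq_mul_min (hν k) (abs_nonneg _))
        (integrable_sq_mul_min (hν k) (by positivity)) fun x => ?_
      dsimp only
      gcongr
    refine (mul_le_mul_of_nonneg_left h8 (by positivity)).trans (le_of_eq ?_)
    rw [h7]; ring
  have hfirst : Tendsto (fun n : ℕ => t n * (∑ k ∈ Finset.range n, p k * ∫ x, x ∂ν k -
      c * Real.log (n + 1))) atTop (𝓝 0) := by
    refine squeeze_zero_norm (a := fun n => |t n| * C) (fun n => ?_) ?_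
    · rw [norm_mul, Real.norm_eq_abs, Real.norm_eq_abs]
      exact mul_le_mul_of_nonneg_left (hmean n) (abs_nonneg _)
    · simpa using ht0.abs.mul_const C
  have hsecond : Tendsto (fun n : ℕ => t n ^ 2 / 2 * ∑ k ∈ Finset.range n, p k * ∫ x, x ^ 2 ∂ν k)
      atTop (𝓝 (v * s ^ 2 / 2)) := by
    have := hvar.const_mul (s ^ 2 / 2)
    rw [show s ^ 2 / 2 * v = v * s ^ 2 / 2 by ring] at this
    refine this.congr' ?_
    filter_upwards [ht2] with n hn
    rw [hn]; ring
  have hexpo : Tendsto (fun n : ℕ => -((t n * (c * Real.log (n + 1)) : ℝ) * Complex.I) +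
      ∑ k ∈ Finset.range n, z n k) atTop (𝓝 (-(v * s ^ 2 / 2 : ℝ))) := by
    have h1 := (((Complex.continuous_ofReal.tendsto _).comp hfirst).mul_const Complex.I)
    have h2 := (Complex.continuous_ofReal.tendsto _).comp hsecond
    have h3 := (h1.sub h2).add hrem
    simp only [Complex.ofReal_zero, zero_mul, zero_sub, add_zero] at h3
    refine h3.congr fun n => ?_
    have e : ∑ k ∈ Finset.range n, z n k = ∑ k ∈ Finset.range n, (p k : ℂ) *
        (charFun (ν k) (t n) - 1 - t n * (∫ x, x ∂ν k : ℝ) * Complex.I +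
          t n ^ 2 / 2 * (∫ x, x ^ 2 ∂ν k : ℝ)) +
        t n * (∑ k ∈ Finset.range n, (p k : ℂ) * (∫ x, x ∂ν k : ℝ)) * Complex.I -
        t n ^ 2 / 2 * ∑ k ∈ Finset.range n, (p k : ℂ) * (∫ x, x ^ 2 ∂ν k : ℝ) := by
      rw [Finset.mul_sum, Finset.sum_mul, Finset.mul_sum, ← Finset.sum_add_distrib,
        ← Finset.sum_sub_distrib]
      exact Finset.sum_congr rfl fun k _ => by rw [hz]; ring
    rw [e]
    simp only [Function.comp_apply]
    push_cast
    ring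
  have hφ : Tendsto (fun n => charFun ν₀ (t n)) atTop (𝓝 1) := by
    have := (continuous_charFun (μ := ν₀)).tendsto 0
    rw [charFun_zero, probReal_univ] at this
    exact this.comp ht0
  have hmain := hφ.mul ((Complex.continuous_exp.tendsto _).comp hexpo)
  rw [one_mul] at hmain
  have herr : Tendsto (fun n : ℕ => Complex.exp (-((t n * (c * Real.log (n + 1)) : ℝ) * Complex.I)) *
      (charFun ν₀ (t n) * (∏ k ∈ Finset.range n, (1 + z n k) -
        Complex.exp (∑ k ∈ Finset.range n, z n k)))) atTop (𝓝 0) := by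
    refine squeeze_zero_norm (a := fun n => t n ^ 2 * K) (fun n => ?_) ?_
    · rw [norm_mul, norm_mul, Complex.norm_exp]
      have h1 : (-((t n * (c * Real.log (n + 1)) : ℝ) * Complex.I)).re = 0 := by
        rw [Complex.neg_re, Complex.re_ofReal_mul, Complex.I_re, mul_zero, neg_zero]
      rw [h1, Real.exp_zero, one_mul]
      calc _ ≤ 1 * (t n ^ 2 * K) :=
            mul_le_mul (norm_charFun_le_one _) (hprod n) (norm_nonneg _) zero_le_one
        _ = _ := one_mul _
    · simpa using (ht0.pow 2).mul_const K
  have := herr.add hmain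
  rw [zero_add] at this
  refine this.congr fun n => ?_
  simp only [Function.comp_apply]
  rw [Complex.exp_add]
  ring

/-! ### Moments of blocks and almost sure properties -/

lemma measurable_integral_depthLaw {f : ℝ → ℝ} (hf : Measurable f) :
    Measurable fun b : Block => ∫ x, f x ∂b.1.depthLaw := by
  have : StronglyMeasurable fun X : HookedSpace => ∫ x, f x ∂depthKernel X :=
    StronglyMeasurable.integral_kernel hf.stronglyMeasurable
  exact this.measurable.comp measurable_fst

lemma measurable_lintegral_depthLaw {f : ℝ → ℝ≥0∞} (hf : Measurable f) :
    Measurable fun b : Block => ∫⁻ x, f x ∂b.1.depthLaw := by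
  have : Measurable fun X : HookedSpace => ∫⁻ x, f x ∂depthKernel X := hf.lintegral_kernel
  exact this.comp measurable_fst

section Moments

variable {Ω : Type*} [MeasurableSpace Ω] {μ : Measure Ω} {B : Ω → Block}

lemma blockMoment_eq_lintegral (p q : ℕ) : blockMoment μ B p q =
    ∫⁻ ω, ((B ω).2 : ℝ≥0∞) ^ p * ∫⁻ x, ENNReal.ofReal x ^ q ∂(B ω).1.depthLaw ∂μ := by
  refine lintegral_congr fun ω => ?_
  rw [lintegral_depthLaw _ (by fun_prop), lintegral_const_mul _ (by fun_prop)]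
  simp only [edist_dist]

lemma ae_integrable_sq (hB : Measurable B) (h : blockMoment μ B 0 2 < ∞) :
    ∀ᵐ ω ∂μ, Integrable (fun x : ℝ => x ^ 2) (B ω).1.depthLaw := by
  rw [blockMoment_eq_lintegral] at h
  simp only [pow_zero, one_mul] at h
  have hm := (measurable_lintegral_depthLaw (f := fun x => ENNReal.ofReal x ^ 2)
    (by fun_prop)).comp hB
  filter_upwards [ae_lt_top hm h.ne] with ω hω
  refine ⟨by fun_prop, ?_⟩
  refine lt_of_eq_of_lt (lintegral_congr_ae ?_) hω
  filter_upwards [(B ω).1.ae_depthLaw_nonneg] with x hx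
  rw [Real.enorm_of_nonneg (by positivity), ENNReal.ofReal_pow hx]

lemma integrable_moment (hB : Measurable B) {p q : ℕ}
    (hq : ∀ᵐ ω ∂μ, Integrable (fun x : ℝ => x ^ q) (B ω).1.depthLaw)
    (h : blockMoment μ B p q < ∞) :
    Integrable (fun ω => ((B ω).2 : ℝ) ^ p * ∫ x, x ^ q ∂(B ω).1.depthLaw) μ ∧
      ∫ ω, ((B ω).2 : ℝ) ^ p * ∫ x, x ^ q ∂(B ω).1.depthLaw ∂μ = (blockMoment μ B p q).toReal := by
  have e : blockMoment μ B p q =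
      ∫⁻ ω, ENNReal.ofReal (((B ω).2 : ℝ) ^ p * ∫ x, x ^ q ∂(B ω).1.depthLaw) ∂μ := by
    rw [blockMoment_eq_lintegral]
    refine lintegral_congr_ae ?_
    filter_upwards [hq] with ω hω
    rw [ENNReal.ofReal_mul (by positivity), ENNReal.ofReal_pow (by positivity),
      ENNReal.ofReal_coe_nnreal, ofReal_integral_eq_lintegral_ofReal hω]
    · congr 1
      refine lintegral_congr_ae ?_
      filter_upwards [(B ω).1.ae_depthLaw_nonneg] with x hx
      rw [ENNReal.ofReal_pow hx]
    · filter_upwards [(B ω).1.ae_depthLaw_nonneg] with x hx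
      exact pow_nonneg hx q
  have hnn : ∀ᵐ ω ∂μ, 0 ≤ ((B ω).2 : ℝ) ^ p * ∫ x, x ^ q ∂(B ω).1.depthLaw := by
    refine ae_of_all _ fun ω => mul_nonneg (by positivity) (integral_nonneg_of_ae ?_)
    filter_upwards [(B ω).1.ae_depthLaw_nonneg] with x hx
    exact pow_nonneg hx q
  have hm : AEStronglyMeasurable
      (fun ω => ((B ω).2 : ℝ) ^ p * ∫ x, x ^ q ∂(B ω).1.depthLaw) μ := by
    have m1 := (measurable_integral_depthLaw (f := fun x => x ^ q) (by fun_prop)).comp hB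
    have m2 : Measurable fun ω => ((B ω).2 : ℝ) ^ p := by fun_prop
    exact (m2.mul m1).aestronglyMeasurable
  rw [e] at h ⊢
  exact ⟨(lintegral_ofReal_ne_top_iff_integrable hm hnn).1 h.ne,
    integral_eq_lintegral_of_nonneg_ae hnn hm⟩

lemma blockMoment_one_zero_lt_top [IsProbabilityMeasure μ] (h : blockMoment μ B 2 0 < ∞) :
    blockMoment μ B 1 0 < ∞ := by
  rw [blockMoment_eq_lintegral] at h ⊢
  simp only [pow_zero, lintegral_one, measure_univ, mul_one, pow_one] at h ⊢
  refine lt_of_le_of_lt (lintegral_mono (g := fun ω => 1 + ((B ω).2 : ℝ≥0∞) ^ 2) fun ω => ?_) ?_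
  · rcases le_total ((B ω).2 : ℝ≥0∞) 1 with h1 | h1
    · exact h1.trans le_self_add
    · exact le_add_left (le_self_pow₀ h1 two_ne_zero)
  · rw [lintegral_add_left measurable_const, lintegral_const, measure_univ, mul_one]
    exact ENNReal.add_lt_top.2 ⟨ENNReal.one_lt_top, h⟩

lemma blockMoment_one_one_lt_top (hB : Measurable B) (h0 : blockMoment μ B 1 0 < ∞)
    (h2 : blockMoment μ B 1 2 < ∞) : blockMoment μ B 1 1 < ∞ := by
  refine lt_of_le_of_lt ?_ (ENNReal.add_lt_top.2 ⟨h0, h2⟩)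
  rw [blockMoment_eq_lintegral, blockMoment_eq_lintegral, blockMoment_eq_lintegral,
    ← lintegral_add_left]
  · refine lintegral_mono fun ω => ?_
    rw [← mul_add, ← lintegral_add_left (by fun_prop)]
    refine mul_le_mul_right (lintegral_mono fun x => ?_) _
    rw [pow_zero, pow_one]
    rcases le_total (ENNReal.ofReal x) 1 with h1 | h1
    · exact h1.trans le_self_add
    · exact le_add_left (le_self_pow₀ h1 two_ne_zero)
  · have m1 := (measurable_lintegral_depthLaw (f := fun x => ENNReal.ofReal x ^ 0)
      (by fun_prop)).comp hB
    have m2 : Measurable fun ω => ((B ω).2 : ℝ≥0∞) ^ 1 := by fun_prop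
    exact m2.mul m1

end Moments

section AlmostSure

variable {Ω : Type*} [MeasurableSpace Ω] {μ : Measure Ω}

lemma ae_summable_of_summable_integral {f : ℕ → Ω → ℝ} (h0 : ∀ k ω, 0 ≤ f k ω)
    (hi : ∀ k, Integrable (f k) μ) (hs : Summable fun k => ∫ ω, f k ω ∂μ) :
    ∀ᵐ ω ∂μ, Summable fun k => f k ω := by
  have hm : ∀ k, AEMeasurable (fun ω => ENNReal.ofReal (f k ω)) μ :=
    fun k => (hi k).aemeasurable.ennreal_ofReal
  have h : ∫⁻ ω, ∑' k, ENNReal.ofReal (f k ω) ∂μ ≠ ∞ := by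
    rw [lintegral_tsum hm]
    have : ∀ k, ∫⁻ ω, ENNReal.ofReal (f k ω) ∂μ = ENNReal.ofReal (∫ ω, f k ω ∂μ) :=
      fun k => (ofReal_integral_eq_lintegral_ofReal (hi k) (ae_of_all _ (h0 k))).symm
    simp only [this]
    exact hs.tsum_ofReal_ne_top
  filter_upwards [ae_lt_top' (AEMeasurable.tsum hm) h] with ω hω
  have := ENNReal.summable_toReal hω.ne
  refine this.congr fun k => ?_
  rw [ENNReal.toReal_ofReal (h0 k ω)]

lemma summable_one_div_mul_sqrt :
    Summable fun k : ℕ => 1 / (((k : ℝ) + 1) * √((k : ℝ) + 1)) := by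
  have h := (summable_nat_add_iff 1).2 (Real.summable_one_div_nat_rpow.2
    (show (1 : ℝ) < 3 / 2 by norm_num))
  refine h.congr fun k => ?_
  have hk : (0 : ℝ) < (k : ℝ) + 1 := by positivity
  rw [Nat.cast_add_one, show (3 / 2 : ℝ) = 1 + 1 / 2 by norm_num, Real.rpow_add hk, Real.rpow_one,
    Real.sqrt_eq_rpow]

lemma summable_one_div_add_one_sq : Summable fun k : ℕ => 1 / ((k : ℝ) + 1) ^ 2 := by
  have h := (summable_nat_add_iff 1).2 (Real.summable_one_div_nat_pow.2 one_lt_two)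
  refine h.congr fun k => ?_
  rw [Nat.cast_add_one]

/-- The centered partial sums of square integrable independent variables are of the order of the
square root of their number, so that they are summable against `k ^ (-2)`, even when multiplied
by further variables which are bounded in `L²`. -/
lemma ae_summable_abs_partial_sum_mul [IsProbabilityMeasure μ] {y w : ℕ → Ω → ℝ}
    (hy : ∀ k, MemLp (y k) 2 μ) (hy0 : ∀ k, ∫ ω, y k ω ∂μ = 0)
    (hindep : Pairwise fun i j => IndepFun (y i) (y j) μ) {V M : ℝ}
    (hV : ∀ k, ∫ ω, y k ω ^ 2 ∂μ = V) (hw : ∀ k, Integrable (fun ω => w k ω ^ 2) μ)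
    (hM : ∀ k, ∫ ω, w k ω ^ 2 ∂μ = M) (hw0 : ∀ k ω, 0 ≤ w k ω) :
    ∀ᵐ ω ∂μ, Summable fun k : ℕ =>
      |∑ j ∈ Finset.range k, y j ω| * w k ω / ((k : ℝ) + 1) ^ 2 := by
  have hY2 : ∀ k, MemLp (fun ω => ∑ j ∈ Finset.range k, y j ω) 2 μ :=
    fun k => memLp_finsetSum _ fun j _ => hy j
  have hYV : ∀ k : ℕ, ∫ ω, (∑ j ∈ Finset.range k, y j ω) ^ 2 ∂μ = k * V := by
    intro k
    have e0 : ∫ ω, (∑ j ∈ Finset.range k, y j ω) ∂μ = 0 := by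
      rw [integral_finsetSum _ fun j _ => (hy j).integrable one_le_two]
      exact Finset.sum_eq_zero fun j _ => hy0 j
    have e1 := variance_of_integral_eq_zero (hY2 k).aemeasurable e0
    have e2 := IndepFun.variance_sum (s := Finset.range k) (X := y) (μ := μ) (fun j _ => hy j)
      fun i _ j _ hij => hindep hij
    have e3 : ∀ j, variance (y j) μ = V := fun j => by
      rw [variance_of_integral_eq_zero (hy j).aemeasurable (hy0 j), hV]
    simp only [e3, Finset.sum_const, Finset.card_range, nsmul_eq_mul] at e2
    rw [← e1, ← e2]
    congr 1
    ext ω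
    simp
  have h1 := ae_summable_of_summable_integral (μ := μ)
    (f := fun k ω => 1 / (((k : ℝ) + 1) * √((k : ℝ) + 1)) *
      ((∑ j ∈ Finset.range k, y j ω) ^ 2 / ((k : ℝ) + 1) + w k ω ^ 2))
    (fun k ω => by positivity)
    (fun k => (((hY2 k).integrable_sq.div_const _).add (hw k)).const_mul _) ?_
  · filter_upwards [h1] with ω hω
    refine Summable.of_nonneg_of_le (fun k => ?_) (fun k => ?_) hω
    · have := hw0 k ω
      positivity
    · set Y := ∑ j ∈ Finset.range k, y j ω
      have hk : (0 : ℝ) < (k : ℝ) + 1 := by positivity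
      have hs : 0 < √((k : ℝ) + 1) := Real.sqrt_pos.2 hk
      have hss := Real.sq_sqrt hk.le
      have key : |Y| / √((k : ℝ) + 1) * w k ω ≤ Y ^ 2 / ((k : ℝ) + 1) + w k ω ^ 2 := by
        have e : Y ^ 2 / ((k : ℝ) + 1) = (|Y| / √((k : ℝ) + 1)) ^ 2 := by
          rw [div_pow, hss, sq_abs]
        rw [e]
        nlinarith [sq_nonneg (|Y| / √((k : ℝ) + 1) - w k ω),
          sq_nonneg (|Y| / √((k : ℝ) + 1)), sq_nonneg (w k ω)]
      have := mul_le_mul_of_nonneg_left key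
        (show 0 ≤ 1 / (((k : ℝ) + 1) * √((k : ℝ) + 1)) by positivity)
      refine le_trans (le_of_eq ?_) this
      calc |Y| * w k ω / ((k : ℝ) + 1) ^ 2
          = |Y| * w k ω / (((k : ℝ) + 1) * √((k : ℝ) + 1) ^ 2) := by rw [hss, ← sq]
        _ = _ := by field_simp
  · refine Summable.of_nonneg_of_le (fun k => integral_nonneg fun ω => by positivity) (fun k => ?_)
      (summable_one_div_mul_sqrt.mul_right (V + M))
    rw [integral_const_mul, integral_add ((hY2 k).integrable_sq.div_const _) (hw k),
      integral_div, hYV, hM]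
    have hV0 : 0 ≤ V := by
      rw [← hV 0]; exact integral_nonneg fun ω => sq_nonneg _
    have : (k : ℝ) * V / ((k : ℝ) + 1) ≤ V := by
      rw [div_le_iff₀ (by positivity)]
      nlinarith
    gcongr

end AlmostSure

section BlockSequence

variable {Ω : Type*} [MeasurableSpace Ω] {μ : Measure Ω} {B : ℕ → Ω → Block}

lemma identDistrib_comp (hident : ∀ n, 1 ≤ n → IdentDistrib (B n) (B 1) μ μ) {g : Block → ℝ}
    (hg : Measurable g) (k : ℕ) :
    IdentDistrib (fun ω => g (B (k + 1) ω)) (fun ω => g (B 1 ω)) μ μ :=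
  (hident (k + 1) (by omega)).comp hg

lemma pairwise_indepFun_comp (hindep : iIndepFun B μ) {g : Block → ℝ} (hg : Measurable g) :
    Pairwise fun i j : ℕ => IndepFun (fun ω => g (B (i + 1) ω)) (fun ω => g (B (j + 1) ω)) μ :=
  fun _ _ hij => (hindep.indepFun (by omega)).comp hg hg

/-- The strong law of large numbers for a functional of the blocks. -/
lemma ae_tendsto_average (hindep : iIndepFun B μ)
    (hident : ∀ n, 1 ≤ n → IdentDistrib (B n) (B 1) μ μ) {g : Block → ℝ} (hg : Measurable g)
    (hint : Integrable (fun ω => g (B 1 ω)) μ) :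
    ∀ᵐ ω ∂μ, Tendsto (fun n : ℕ => (∑ k ∈ Finset.range n, g (B (k + 1) ω)) / ((n : ℝ) + 1)) atTop
      (𝓝 (∫ ω, g (B 1 ω) ∂μ)) := by
  filter_upwards [strong_law_ae_real (fun k ω => g (B (k + 1) ω)) hint
    (pairwise_indepFun_comp hindep hg) fun k => identDistrib_comp hident hg k] with ω hω
  have h1 := hω.mul (tendsto_natCast_div_add_atTop (1 : ℝ))
  rw [mul_one] at h1
  refine h1.congr' ?_
  filter_upwards [eventually_gt_atTop 0] with n hn
  exact div_mul_div_cancel₀ (by positivity)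

lemma ae_summable_div_sq (hident : ∀ n, 1 ≤ n → IdentDistrib (B n) (B 1) μ μ) {g : Block → ℝ}
    (hg : Measurable g) (hg0 : ∀ b, 0 ≤ g b) (hint : Integrable (fun ω => g (B 1 ω)) μ) :
    ∀ᵐ ω ∂μ, Summable fun k : ℕ => g (B (k + 1) ω) / ((k : ℝ) + 1) ^ 2 := by
  refine ae_summable_of_summable_integral (fun k ω => div_nonneg (hg0 _) (sq_nonneg _))
    (fun k => ((identDistrib_comp hident hg k).integrable_iff.2 hint).div_const _) ?_
  simp only [integral_div, (identDistrib_comp hident hg _).integral_eq]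
  refine (summable_one_div_add_one_sq.mul_left (∫ ω, g (B 1 ω) ∂μ)).congr fun k => ?_
  rw [mul_one_div]

end BlockSequence

/-! ### The central limit theorem for given blocks -/

section Quenched

variable {Ω : Type*} [MeasurableSpace Ω] {μ : Measure Ω} {B : ℕ → Ω → Block}

lemma tendsto_integral_sq_mul_min {ν : Measure ℝ} (h : Integrable (fun x : ℝ => x ^ 2) ν) :
    Tendsto (fun j : ℕ => ∫ x, x ^ 2 * min 1 (1 / ((j : ℝ) + 1) * |x|) ∂ν) atTop (𝓝 0) := by
  have := tendsto_integral_of_dominated_convergence (μ := ν) (f := fun _ : ℝ => (0 : ℝ))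
    (F := fun (j : ℕ) x => x ^ 2 * min 1 (1 / ((j : ℝ) + 1) * |x|)) (fun x => x ^ 2)
    (fun j => by fun_prop) h (fun j => ae_of_all _ fun x => ?_) (ae_of_all _ fun x => ?_)
  · simpa using this
  · rw [Real.norm_of_nonneg (by positivity)]
    exact mul_le_of_le_one_right (sq_nonneg x) (min_le_left _ _)
  · have h1 := ((tendsto_one_div_add_atTop_nhds_zero_nat (𝕜 := ℝ)).mul_const |x|)
    have h2 := ((tendsto_const_nhds (x := (1 : ℝ))).min h1).const_mul (x ^ 2)
    simpa using h2

/-- The mean distance from the hook to a random point of the block. -/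
noncomputable def meanDepth (b : Block) : ℝ := ∫ x, x ∂b.1.depthLaw

/-- The mean square distance from the hook to a random point of the block. -/
noncomputable def sqDepth (b : Block) : ℝ := ∫ x, x ^ 2 ∂b.1.depthLaw

/-- The mean of `D ^ 2 * min 1 (D / (j + 1))`, where `D` is the distance from the hook to a random
point of the block. It bounds the remainder of the second order expansion of the characteristic
function of `D` at arguments of absolute value at most `1 / (j + 1)`. -/
noncomputable def truncSqDepth (j : ℕ) (b : Block) : ℝ :=
  ∫ x, x ^ 2 * min 1 (1 / ((j : ℝ) + 1) * |x|) ∂b.1.depthLaw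

lemma measurable_meanDepth : Measurable meanDepth := measurable_integral_depthLaw (by fun_prop)

lemma measurable_sqDepth : Measurable sqDepth := measurable_integral_depthLaw (by fun_prop)

lemma measurable_truncSqDepth (j : ℕ) : Measurable (truncSqDepth j) :=
  measurable_integral_depthLaw (by fun_prop)

lemma sqDepth_nonneg (b : Block) : 0 ≤ sqDepth b := integral_nonneg fun x => sq_nonneg x

lemma truncSqDepth_nonneg (j : ℕ) (b : Block) : 0 ≤ truncSqDepth j b :=
  integral_nonneg fun x => by positivity

lemma truncSqDepth_le_sqDepth (j : ℕ) {b : Block}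
    (h : Integrable (fun x : ℝ => x ^ 2) b.1.depthLaw) : truncSqDepth j b ≤ sqDepth b := by
  refine integral_mono (integrable_sq_mul_min h (by positivity)) h fun x => ?_
  exact mul_le_of_le_one_right (sq_nonneg x) (min_le_left _ _)

lemma meanDepth_sq_le_sqDepth {b : Block} (h : Integrable (fun x : ℝ => x ^ 2) b.1.depthLaw) :
    meanDepth b ^ 2 ≤ sqDepth b := by
  refine le_trans ?_ (sq_integral_abs_le h)
  rw [← sq_abs]
  gcongr
  exact abs_integral_le_integral_abs

/-- The central limit theorem for given blocks: if their weights and depth moments obey laws of large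
numbers, then so do the weighted sums which determine the characteristic function of the depth of a
latch. -/
lemma tendsto_charFun_meanDepthLaw {b : ℕ → Block} (hW₀ : 0 < (b 0).2) {a c v : ℝ} (ha : 0 < a)
    (hweight : Tendsto (fun n : ℕ => (∑ k ∈ Finset.range n, ((b (k + 1)).2 : ℝ)) / ((n : ℝ) + 1)) atTop
      (𝓝 a))
    (hcentered : Tendsto (fun n : ℕ => (∑ k ∈ Finset.range n,
      ((b (k + 1)).2 : ℝ) * (meanDepth (b (k + 1)) - c)) / ((n : ℝ) + 1)) atTop (𝓝 0))
    (hsquare : Tendsto (fun n : ℕ => (∑ k ∈ Finset.range n,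
      ((b (k + 1)).2 : ℝ) * sqDepth (b (k + 1))) / ((n : ℝ) + 1)) atTop (𝓝 v))
    {r : ℕ → ℝ}
    (htrunc : ∀ j : ℕ, Tendsto (fun n : ℕ => (∑ k ∈ Finset.range n,
      ((b (k + 1)).2 : ℝ) * truncSqDepth j (b (k + 1))) / ((n : ℝ) + 1)) atTop (𝓝 (r j)))
    (hr : Tendsto r atTop (𝓝 0))
    (hW_summable : Summable fun k : ℕ => ((b (k + 1)).2 : ℝ) ^ 2 / ((k : ℝ) + 1) ^ 2)
    (hsq_summable : Summable fun k : ℕ =>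
      ((b (k + 1)).2 : ℝ) ^ 2 * sqDepth (b (k + 1)) / ((k : ℝ) + 1) ^ 2)
    (hpartial : Summable fun k : ℕ => |∑ j ∈ Finset.range k,
      ((b (j + 1)).2 : ℝ) * (meanDepth (b (j + 1)) - c)| * ((b (k + 1)).2 : ℝ) / ((k : ℝ) + 1) ^ 2)
    (hint : ∀ k : ℕ, Integrable (fun x : ℝ => x ^ 2) (b (k + 1)).1.depthLaw) (s : ℝ) :
    Tendsto (fun n : ℕ =>
      Complex.exp (-((s / √(Real.log (n + 1)) * (c * Real.log (n + 1)) : ℝ) * Complex.I)) *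
        charFun (meanDepthLaw b n) (s / √(Real.log (n + 1)))) atTop
      (𝓝 (Complex.exp (-(v / a * s ^ 2 / 2 : ℝ)))) := by
  let S : ℕ → ℝ := fun n => (totalWeight b n : ℝ)
  let w : ℕ → ℝ := fun k => (b (k + 1)).2
  have hpos : ∀ n, 0 < S n := fun n =>
    NNReal.coe_pos.2 (totalWeight_pos hW₀ n)
  have hS : ∀ n, S (n + 1) = S n + w n := fun n => by
    simp only [S, totalWeight_succ, NNReal.coe_add]
    rfl
  have hw : ∀ n, 0 ≤ w n := fun n => NNReal.coe_nonneg _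
  have hlim : Tendsto (fun n : ℕ => S n / (n + 1)) atTop (𝓝 a) := by
    have h0 : Tendsto (fun n : ℕ => S 0 * (1 / ((n : ℝ) + 1))) atTop (𝓝 0) := by
      simpa using (tendsto_one_div_add_atTop_nhds_zero_nat (𝕜 := ℝ)).const_mul (S 0)
    have := h0.add hweight
    rw [zero_add] at this
    refine this.congr fun n => ?_
    rw [eq_add_sum_range hS n, add_div, mul_one_div]
  obtain ⟨C₁, hC₁⟩ := exists_sum_div_sub_log_le hpos hS hw ha hlim hW_summable
  obtain ⟨C₂, hC₂⟩ := exists_centered_sum_le hpos hS hw ha hlim hcentered hpartial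
  -- as `wₖ * mₖ = wₖ * (mₖ - c) + c * wₖ`, the sum splits into a bounded one and a multiple of
  -- `∑ wₖ / Sₖ₊₁ = ln n + O(1)`
  have hmean : ∀ n : ℕ, |(∑ k ∈ Finset.range n, w k / S (k + 1) * meanDepth (b (k + 1))) -
      c * Real.log (n + 1)| ≤ C₂ + |c| * C₁ := by
    intro n
    have e : (∑ k ∈ Finset.range n, w k / S (k + 1) * meanDepth (b (k + 1))) - c * Real.log (n + 1) =
        ∑ k ∈ Finset.range n, (b (k + 1)).2 * (meanDepth (b (k + 1)) - c) / S (k + 1) +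
          c * (∑ k ∈ Finset.range n, w k / S (k + 1) - Real.log (n + 1)) := by
      rw [mul_sub, Finset.mul_sum, ← add_sub_assoc, ← Finset.sum_add_distrib]
      congr 1
      refine Finset.sum_congr rfl fun k _ => ?_
      simp only [w]
      ring
    rw [e]
    refine (abs_add_le _ _).trans (add_le_add (hC₂ n) ?_)
    rw [abs_mul]
    exact mul_le_mul_of_nonneg_left (hC₁ n) (abs_nonneg c)
  have hvar := tendsto_weighted_sum_div_log hpos hS hw ha hlim hW_summable hsquare
  have key := tendsto_prod_charFun hpos hS hw ha hlim (b 0).1.depthLaw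
    (fun k => (b (k + 1)).1.depthLaw) hint hmean
    (hvar.congr fun n => by
      congr 1
      refine Finset.sum_congr rfl fun k _ => ?_
      simp only [w, sqDepth]
      ring)
    hsq_summable (r := fun j => r j / a) (by simpa using hr.div_const a)
    (fun j => (tendsto_weighted_sum_div_log hpos hS hw ha hlim hW_summable (htrunc j)).congr
      fun n => by
      congr 1
      refine Finset.sum_congr rfl fun k _ => ?_
      simp only [w, truncSqDepth]
      ring) s
  refine key.congr fun n => ?_
  rw [charFun_meanDepthLaw b hW₀]
  simp only [w, S, NNReal.coe_div]

lemma memLp_mul_sub_const [IsProbabilityMeasure μ] {W m q : Ω → ℝ} (hW : Measurable W)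
    (hm : Measurable m) (h2 : Integrable (fun ω => W ω ^ 2) μ)
    (hq : Integrable (fun ω => W ω ^ 2 * q ω) μ) (hmq : ∀ᵐ ω ∂μ, m ω ^ 2 ≤ q ω) (c : ℝ) :
    MemLp (fun ω => W ω * (m ω - c)) 2 μ := by
  refine (memLp_two_iff_integrable_sq (by fun_prop)).2 ?_
  refine Integrable.mono' (g := fun ω => 2 * (W ω ^ 2 * q ω) + 2 * c ^ 2 * W ω ^ 2)
    ((hq.const_mul 2).add (h2.const_mul _)) (by fun_prop) ?_
  filter_upwards [hmq] with ω hω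
  rw [Real.norm_of_nonneg (sq_nonneg _)]
  have h1 := mul_le_mul_of_nonneg_left hω (sq_nonneg (W ω))
  nlinarith [sq_nonneg (W ω * (m ω + c))]

/-- The central limit theorem for almost every sequence of blocks. -/
lemma ae_tendsto_charFun_meanDepthLaw [IsProbabilityMeasure μ] (hB : ∀ n, Measurable (B n))
    (hindep : iIndepFun B μ) (hident : ∀ n, 1 ≤ n → IdentDistrib (B n) (B 1) μ μ)
    (hW₀ : ∀ᵐ ω ∂μ, 0 < (B 0 ω).2) (hW : 0 < blockMoment μ (B 1) 1 0)
    (h20 : blockMoment μ (B 1) 2 0 < ∞) (h22 : blockMoment μ (B 1) 2 2 < ∞)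
    (h12 : blockMoment μ (B 1) 1 2 < ∞) (h02 : blockMoment μ (B 1) 0 2 < ∞) (s : ℝ) :
    ∀ᵐ ω ∂μ, Tendsto (fun n : ℕ =>
      Complex.exp (-((s / √(Real.log (n + 1)) * ((blockMoment μ (B 1) 1 0).toReal⁻¹ *
        (blockMoment μ (B 1) 1 1).toReal * Real.log (n + 1)) : ℝ) * Complex.I)) *
        charFun (meanDepthLaw (fun j => B j ω) n) (s / √(Real.log (n + 1)))) atTop
      (𝓝 (Complex.exp (-((blockMoment μ (B 1) 1 2).toReal / (blockMoment μ (B 1) 1 0).toReal *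
        s ^ 2 / 2 : ℝ)))) := by
  have hB1 := hB 1
  have h10 := blockMoment_one_zero_lt_top h20
  have h11 := blockMoment_one_one_lt_top hB1 h10 h12
  have hsq1 := ae_integrable_sq hB1 h02
  have hone : ∀ᵐ ω ∂μ, Integrable (fun x : ℝ => x ^ 0) (B 1 ω).1.depthLaw :=
    ae_of_all _ fun ω => by simp
  have hid1 : ∀ᵐ ω ∂μ, Integrable (fun x : ℝ => x ^ 1) (B 1 ω).1.depthLaw := by
    filter_upwards [hsq1] with ω hω
    simpa using integrable_id_of_sq hω
  set a := (blockMoment μ (B 1) 1 0).toReal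
  have ha : 0 < a := ENNReal.toReal_pos hW.ne' h10.ne
  set c := a⁻¹ * (blockMoment μ (B 1) 1 1).toReal with hc
  let W : Block → ℝ := fun b => b.2
  have mW : Measurable W := by fun_prop
  have W0 : ∀ b, 0 ≤ W b := fun b => NNReal.coe_nonneg _
  have iW : Integrable (fun ω => W (B 1 ω)) μ ∧ ∫ ω, W (B 1 ω) ∂μ = a := by
    simpa using integrable_moment hB1 hone h10
  have iW2 : Integrable (fun ω => W (B 1 ω) ^ 2) μ := by
    simpa using (integrable_moment hB1 hone h20).1
  have iWm : Integrable (fun ω => W (B 1 ω) * meanDepth (B 1 ω)) μ ∧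
      ∫ ω, W (B 1 ω) * meanDepth (B 1 ω) ∂μ = (blockMoment μ (B 1) 1 1).toReal := by
    simpa [meanDepth] using integrable_moment hB1 hid1 h11
  have iWq : Integrable (fun ω => W (B 1 ω) * sqDepth (B 1 ω)) μ ∧
      ∫ ω, W (B 1 ω) * sqDepth (B 1 ω) ∂μ = (blockMoment μ (B 1) 1 2).toReal := by
    simpa [sqDepth] using integrable_moment hB1 hsq1 h12
  have iW2q : Integrable (fun ω => W (B 1 ω) ^ 2 * sqDepth (B 1 ω)) μ :=
    (integrable_moment hB1 hsq1 h22).1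
  have Wρq : ∀ j, ∀ᵐ ω ∂μ, ‖W (B 1 ω) * truncSqDepth j (B 1 ω)‖ ≤ W (B 1 ω) * sqDepth (B 1 ω) := fun j => by
    filter_upwards [hsq1] with ω hω
    rw [Real.norm_of_nonneg (mul_nonneg (W0 _) (truncSqDepth_nonneg _ _))]
    exact mul_le_mul_of_nonneg_left (truncSqDepth_le_sqDepth j hω) (W0 _)
  have iWρ : ∀ j, Integrable (fun ω => W (B 1 ω) * truncSqDepth j (B 1 ω)) μ := fun j =>
    iWq.1.mono' ((mW.mul (measurable_truncSqDepth j)).comp hB1).aestronglyMeasurable (Wρq j)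
  have hr : Tendsto (fun j => ∫ ω, W (B 1 ω) * truncSqDepth j (B 1 ω) ∂μ) atTop (𝓝 0) := by
    have := tendsto_integral_of_dominated_convergence (μ := μ) (f := fun _ => (0 : ℝ))
      (F := fun j ω => W (B 1 ω) * truncSqDepth j (B 1 ω)) (fun ω => W (B 1 ω) * sqDepth (B 1 ω))
      (fun j => (iWρ j).aestronglyMeasurable) iWq.1 Wρq ?_
    · simpa using this
    · filter_upwards [hsq1] with ω hω
      have := (tendsto_integral_sq_mul_min hω).const_mul (W (B 1 ω))
      rwa [mul_zero] at this
  -- centering by `c * W` instead of by a constant leaves `c * ∑ pₖ`, which telescopes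
  let y : Block → ℝ := fun b => W b * (meanDepth b - c)
  have my : Measurable y := mW.mul (measurable_meanDepth.sub_const c)
  have iy : Integrable (fun ω => y (B 1 ω)) μ ∧ ∫ ω, y (B 1 ω) ∂μ = 0 := by
    have e : (fun ω => y (B 1 ω)) = fun ω => W (B 1 ω) * meanDepth (B 1 ω) - c * W (B 1 ω) := by
      ext ω; simp only [y]; ring
    rw [e]
    refine ⟨iWm.1.sub (iW.1.const_mul c), ?_⟩
    rw [integral_sub iWm.1 (iW.1.const_mul c), integral_const_mul, iWm.2, iW.2, hc]
    field_simp
    ring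
  have hy2 : MemLp (fun ω => y (B 1 ω)) 2 μ :=
    memLp_mul_sub_const (mW.comp hB1) (measurable_meanDepth.comp hB1) iW2 iW2q
      (hsq1.mono fun ω hω => meanDepth_sq_le_sqDepth hω) c
  -- almost sure properties of the sequence of blocks
  have A1 := ae_tendsto_average hindep hident mW iW.1
  have A2 := ae_tendsto_average hindep hident my iy.1
  have A3 := ae_tendsto_average hindep hident
    (g := fun b => W b * sqDepth b) (mW.mul measurable_sqDepth) iWq.1
  have A4 : ∀ᵐ ω ∂μ, ∀ j : ℕ, Tendsto (fun n : ℕ => (∑ k ∈ Finset.range n,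
      (W (B (k + 1) ω) * truncSqDepth j (B (k + 1) ω))) / ((n : ℝ) + 1)) atTop
      (𝓝 (∫ ω, W (B 1 ω) * truncSqDepth j (B 1 ω) ∂μ)) :=
    ae_all_iff.2 fun j => ae_tendsto_average hindep hident
      (g := fun b => W b * truncSqDepth j b) (mW.mul (measurable_truncSqDepth j)) (iWρ j)
  have A5 := ae_summable_div_sq hident (mW.pow_const 2) (fun b => sq_nonneg (W b)) iW2
  have A6 := ae_summable_div_sq hident (g := fun b => W b ^ 2 * sqDepth b) ((mW.pow_const 2).mul measurable_sqDepth)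
    (fun b => mul_nonneg (sq_nonneg (W b)) (sqDepth_nonneg b)) iW2q
  have A7 := ae_summable_abs_partial_sum_mul (μ := μ) (y := fun k ω => y (B (k + 1) ω))
    (w := fun k ω => W (B (k + 1) ω))
    (fun k => (identDistrib_comp hident my k).memLp_iff.2 hy2)
    (fun k => (identDistrib_comp hident my k).integral_eq.trans iy.2)
    (pairwise_indepFun_comp hindep my)
    (fun k => (identDistrib_comp hident (my.pow_const 2) k).integral_eq)
    (fun k => (identDistrib_comp hident (mW.pow_const 2) k).integrable_iff.2 iW2)
    (fun k => (identDistrib_comp hident (mW.pow_const 2) k).integral_eq)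
    (fun k ω => W0 _)
  have A8 : ∀ᵐ ω ∂μ, ∀ k : ℕ, Integrable (fun x : ℝ => x ^ 2) (B (k + 1) ω).1.depthLaw := by
    have hm : MeasurableSet {b : Block | Integrable (fun x : ℝ => x ^ 2) b.1.depthLaw} := by
      have e : {b : Block | Integrable (fun x : ℝ => x ^ 2) b.1.depthLaw} =
          {b : Block | ∫⁻ x, ‖x ^ 2‖ₑ ∂b.1.depthLaw < ∞} := by
        ext b
        exact ⟨fun h => h.2, fun h => ⟨by fun_prop, h⟩⟩
      rw [e]
      exact measurableSet_lt (measurable_lintegral_depthLaw (by fun_prop)) measurable_const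
    exact ae_all_iff.2 fun k => (hident (k + 1) (by omega)).symm.ae_snd hm hsq1
  refine (hW₀.and (A1.and (A2.and (A3.and (A4.and (A5.and (A6.and (A7.and A8)))))))).mono ?_
  rintro ω ⟨H0, H1, H2, H3, H4, H5, H6, H7, H8⟩
  rw [iW.2] at H1
  rw [iy.2] at H2
  rw [iWq.2] at H3
  exact tendsto_charFun_meanDepthLaw (b := fun j => B j ω) H0 ha H1 H2 H3 H4 hr H5 H6 H7 H8 s

end Quenched

/-! ### The limit theorems for insertion depths -/

/-- Convergence in distribution to a real random variable, after division by a sequence which tends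
to infinity, becomes convergence to zero in probability. -/
lemma tendstoInMeasure_div_of_tendstoInDistribution {Ω Ω' : Type*} [MeasurableSpace Ω]
    [MeasurableSpace Ω'] {μ : Measure Ω} [IsProbabilityMeasure μ] {μ' : Measure Ω'}
    [IsProbabilityMeasure μ'] {X : ℕ → Ω → ℝ} {Z : Ω' → ℝ}
    (h : TendstoInDistribution X atTop Z (fun _ => μ) μ') {b : ℕ → ℝ} (hb : Tendsto b atTop atTop) :
    TendstoInMeasure μ (fun n ω => X n ω / b n) atTop fun _ => 0 := by
  have hc : TendstoInMeasure μ (fun (n : ℕ) (_ : Ω) => (b n)⁻¹) atTop fun _ => (0 : ℝ) :=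
    tendstoInMeasure_of_tendsto_ae (fun n => by fun_prop)
      (ae_of_all _ fun _ => hb.inv_tendsto_atTop)
  have h0 := (h.continuous_comp_prodMk_of_tendstoInMeasure_const
    (g := fun p : ℝ × ℝ => p.1 * p.2) (by fun_prop) hc (fun n => by fun_prop)).tendsto
  intro ε hε
  have hcl : IsClosed {x : ℝ | ε ≤ edist x 0} :=
    isClosed_le continuous_const (by fun_prop)
  have hX := h.forall_aemeasurable
  have hlim := ProbabilityMeasure.limsup_measure_closed_le_of_tendsto h0 hcl
  have hz : μ'.map (fun ω => Z ω * (0 : ℝ)) {x : ℝ | ε ≤ edist x 0} = 0 := by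
    simp only [mul_zero]
    rw [Measure.map_const, Measure.smul_apply, Measure.dirac_apply' _ hcl.measurableSet]
    simp [hε.ne']
  refine tendsto_of_le_liminf_of_limsup_le zero_le ?_
  refine le_trans (le_of_eq ?_) (hlim.trans hz.le)
  refine limsup_congr (Eventually.of_forall fun n => ?_)
  change _ = μ.map (fun ω => X n ω * (b n)⁻¹) {x : ℝ | ε ≤ edist x 0}
  rw [Measure.map_apply_of_aemeasurable ((hX n).mul_const _) hcl.measurableSet]
  rfl

theorem theorem1 {Ω : Type*} [MeasurableSpace Ω] (μ : Measure Ω) [IsProbabilityMeasure μ]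
    (B : ℕ → Ω → Block) (Δ : ℕ → Ω → ℝ)
    (hB : ∀ n, Measurable (B n))
    (hindep : iIndepFun B μ)
    (hident : ∀ n, 1 ≤ n → IdentDistrib (B n) (B 1) μ μ)
    (hW₀ : ∀ᵐ ω ∂μ, 0 < (B 0 ω).2)
    (hW : 0 < blockMoment μ (B 1) 1 0)
    (hΔ : IsInsertionDepth μ B Δ)
    (h20 : blockMoment μ (B 1) 2 0 < ∞)
    (h22 : blockMoment μ (B 1) 2 2 < ∞)
    (h12 : blockMoment μ (B 1) 1 2 < ∞)
    (h02 : blockMoment μ (B 1) 0 2 < ∞) :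
    TendstoInMeasure μ (fun (n : ℕ) ω => Δ n ω / Real.log n) atTop
      (fun _ => (blockMoment μ (B 1) 1 1).toReal / (blockMoment μ (B 1) 1 0).toReal) ∧
    TendstoInDistribution
      (fun (n : ℕ) ω =>
        (Δ n ω - (blockMoment μ (B 1) 1 0).toReal⁻¹ * (blockMoment μ (B 1) 1 1).toReal *
          Real.log n) / √(Real.log n))
      atTop id (fun _ => μ)
      (gaussianReal 0
        ((blockMoment μ (B 1) 1 0).toNNReal⁻¹ * (blockMoment μ (B 1) 1 2).toNNReal)) := by
  set c := (blockMoment μ (B 1) 1 0).toReal⁻¹ * (blockMoment μ (B 1) 1 1).toReal with hc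
  set v := (blockMoment μ (B 1) 1 0).toNNReal⁻¹ * (blockMoment μ (B 1) 1 2).toNNReal with hv
  have hmeas : ∀ n : ℕ, Measurable fun ω => (Δ n ω - c * Real.log n) / √(Real.log n) :=
    fun n => ((hΔ.measurable n).sub_const _).div_const _
  have hclt : TendstoInDistribution
      (fun (n : ℕ) ω => (Δ n ω - c * Real.log n) / √(Real.log n)) atTop id (fun _ => μ)
      (gaussianReal 0 v) := by
    refine ⟨fun n => (hmeas n).aemeasurable, aemeasurable_id, ?_⟩
    refine (tendsto_add_atTop_iff_nat 1).1
      (ProbabilityMeasure.tendsto_iff_tendsto_charFun.2 fun s => ?_)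
    have hlim := tendsto_integral_of_dominated_convergence (μ := μ) (fun _ => (1 : ℝ))
      (F := fun (n : ℕ) ω =>
        Complex.exp (-((s / √(Real.log (n + 1)) * (c * Real.log (n + 1)) : ℝ) * Complex.I)) *
          charFun (meanDepthLaw (fun j => B j ω) n) (s / √(Real.log (n + 1))))
      (f := fun _ => Complex.exp (-(v * s ^ 2 / 2 : ℝ)))
      (fun n => ((((stronglyMeasurable_charFun_meanDepthLaw n _).comp_measurable
        (measurable_pi_lambda _ hB)).const_mul _).aestronglyMeasurable))
      (integrable_const _)
      (fun n => ae_of_all _ fun ω => ?_) ?_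
    · simp only [integral_const_mul, ← hΔ.charFun_map hB hW₀, integral_const, probReal_univ,
        one_smul] at hlim
      simp only [ProbabilityMeasure.coe_mk, Measure.map_id, charFun_gaussianReal]
      convert hlim using 2 with n
      · rw [charFun_apply_real, charFun_apply_real,
          integral_map (hmeas _).aemeasurable (by fun_prop),
          integral_map (hΔ.measurable _).aemeasurable (by fun_prop), ← integral_const_mul]
        refine integral_congr_ae (ae_of_all _ fun ω => ?_)
        dsimp only
        rw [← Complex.exp_add]
        congr 1
        push_cast
        ring
      · congr 1
        push_cast
        ring
    · rw [norm_mul, Complex.norm_exp, Complex.neg_re, Complex.re_ofReal_mul, Complex.I_re,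
        mul_zero, neg_zero, Real.exp_zero, one_mul]
      exact norm_charFun_meanDepthLaw_le _ _ _
    · have hv' : (v : ℝ) =
          (blockMoment μ (B 1) 1 2).toReal / (blockMoment μ (B 1) 1 0).toReal := by
        rw [hv, div_eq_inv_mul]; push_cast; rfl
      rw [hv']
      exact ae_tendsto_charFun_meanDepthLaw hB hindep hident hW₀ hW h20 h22 h12 h02 s
  refine ⟨?_, hclt⟩
  have hb : Tendsto (fun n : ℕ => √(Real.log n)) atTop atTop :=
    Real.tendsto_sqrt_atTop.comp (Real.tendsto_log_atTop.comp tendsto_natCast_atTop_atTop)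
  have h := tendstoInMeasure_div_of_tendstoInDistribution hclt hb
  rw [tendstoInMeasure_iff_norm] at h ⊢
  intro ε hε
  refine (h ε hε).congr' ?_
  filter_upwards [eventually_gt_atTop 1] with n hn
  have hl : 0 < Real.log n := Real.log_pos (by exact_mod_cast hn)
  have e : ∀ ω, (Δ n ω - c * Real.log n) / √(Real.log n) / √(Real.log n) - 0 =
      Δ n ω / Real.log n -
        (blockMoment μ (B 1) 1 1).toReal / (blockMoment μ (B 1) 1 0).toReal := by
    intro ω
    rw [div_div, Real.mul_self_sqrt hl.le, sub_zero, sub_div, mul_div_cancel_right₀ _ hl.ne', hc,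
      inv_mul_eq_div]
  simp only [e]
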